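/- **Setting.** Let $\Omega\subset\mathbb R^2$ be a bounded domain with polygonal boundary and let $\mathcal T_h$ be a decomposition of $\Omega$ into finitely many open non-overlapping polygons. For $K\in\mathcal T_h$ let $h_K$ be its diameter; for an edge $e$ of $K$ let $h_e$ be the length of $e$ and $\nu_e$ a unit normal of $e$ (only its direction matters below; take it outward with respect to $K$). Assume that $\mathcal T_h$ is regular with constant $C_{\mathcal T}>0$: for every $K\in\mathcal T_h$, every edge of $K$ is longer than $C_{\mathcal T}h_K$, and $K$ is star-shaped with respect to a ball of radius $C_{\mathcal T}h_K$ with centre in $K$. For an integer $k\ge 0$, let $\mathrm P_\ell$ denote polynomials of degree at most $\ell$ ($\mathrm P_{-1}=\{0\}$), and let $$H_h^K=\{\sigma\in H(\mathrm{div};K)\cap H(\mathrm{rot};K):\ \sigma\cdot\nu|_e\in \mathrm P_k(e)\ \text{for every edge } e\subset\partial K,\ \mathrm{div}\,\sigma\in \mathrm P_k(K),\ \mathrm{rot}\,\sigma\in \mathrm P_{k-1}(K)\},$$ where the normal component of $\sigma\in H(\mathrm{div};K)$ is defined by Green's formula and $\mathrm{rot}\,\sigma=\partial_1\sigma_2-\partial_2\sigma_1$.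 For $\tau\in[H^1(\Omega)]^2$, a field $\tau_I$ is called the virtual element interpolant of $\tau$ if $\tau_I\in H(\mathrm{div};\Omega)$, $\tau_I|_K\in H_h^K$ for all $K\in\mathcal T_h$, and, for every $K\in\mathcal T_h$, $$\int_e q\,\tau_I\cdot\nu_e=\int_e q\,\tau\cdot\nu_e\quad\forall q\in \mathrm P_k(e),\ \forall\,\text{edges } e \text{ of } K,$$ $$\int_K \tau_I\cdot\nabla q=\int_K\tau\cdot\nabla q\quad\forall q\in \mathrm P_k(K),\qquad \int_K\tau_I\cdot\eta=\int_K\tau\cdot\eta\quad\forall \eta\in[\mathrm P_k(K)]^2 \text{ with } \eta\perp_{L^2(K)}\nabla \mathrm P_{k+1}(K).$$ **Lemma.** For every $C_{\mathcal T}>0$ there is a constant $c_3>0$, depending only on $C_{\mathcal T}$ (in particular independent of $h$), such that for all $\Omega$, $\mathcal T_h$, $k$ as above, all $\tau\in[H^1(\Omega)]^2$ with virtual element interpolant $\tau_I$, every $K\in\mathcal T_h$ and every edge $e$ of $K$, the trace of $\tau$ and the normal component of $\tau_I$ on $e$ exist in $L^2(e)$ and $$\|(\tau-\tau_I)\cdot\nu_e\|_{L^2(e)}\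 \le\ c_3\,h_e^{1/2}\,|\tau|_{1,K},\qquad |\tau|_{1,K}^2=\sum_{j=1}^2\int_K|\nabla\tau_j|^2 .$$ -/

import Mathlib

open MeasureTheory Filter Topology Set
open scoped ContDiff RealInnerProductSpace

noncomputable section

namespace MixedVEM

/-- The Euclidean plane. -/
abbrev Plane : Type := EuclideanSpace ℝ (Fin 2)

/-! ### Polynomials -/

/-- `f` is (the function of) a polynomial in two variables of total degree at most `m`. The degree
is an integer, so that the only member for `m = -1` is the zero function. Restricted to a polygon
or to an edge, these functions form the spaces of polynomials of degree at most `m` on it. -/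
def IsPoly (m : ℤ) (f : Plane → ℝ) : Prop :=
  ∃ p : MvPolynomial (Fin 2) ℝ, (∀ α ∈ p.support, ((α.degree : ℕ) : ℤ) ≤ m) ∧
    ∀ x : Plane, f x = MvPolynomial.eval (fun i => x i) p

/-! ### Weak derivatives -/

/-- `φ` is a smooth function on the plane with compact support inside `U`. -/
structure IsTest (U : Set Plane) (φ : Plane → ℝ) : Prop where
  smooth : ContDiff ℝ ∞ φ
  compact : HasCompactSupport φ
  supp : tsupport φ ⊆ U

/-- The scalar function `u` belongs to `H¹(U)`, with weak gradient `G`. -/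
structure IsH1 (U : Set Plane) (u : Plane → ℝ) (G : Plane → Plane) : Prop where
  memLp : MemLp u 2 (volume.restrict U)
  memLp_grad : MemLp G 2 (volume.restrict U)
  weak : ∀ φ, IsTest U φ → ∀ v : Plane,
    ∫ x in U, u x * fderiv ℝ φ x v = - ∫ x in U, ⟪G x, v⟫ * φ x

/-- The vector field `τ` belongs to `[H¹(U)]²`; `G j` is the weak gradient of its `j`-th
component. -/
def IsVecH1 (U : Set Plane) (τ : Plane → Plane) (G : Fin 2 → Plane → Plane) : Prop :=
  ∀ j, IsH1 U (fun x => τ x j) (G j)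

/-- The `H¹(U)` seminorm of a vector field whose components have the weak gradients `G j`. -/
def h1Seminorm (U : Set Plane) (G : Fin 2 → Plane → Plane) : ℝ :=
  Real.sqrt (∑ j, ∫ x in U, ‖G j x‖ ^ 2)

/-- `d` is the weak divergence of `σ` in `U`
(here `fderiv ℝ φ x (σ x)` is the product of `σ x` and the gradient of `φ` at `x`). -/
def HasWeakDiv (U : Set Plane) (σ : Plane → Plane) (d : Plane → ℝ) : Prop :=
  ∀ φ, IsTest U φ → ∫ x in U, fderiv ℝ φ x (σ x) = - ∫ x in U, d x * φ x

/-- `r` is the weak rotation `∂₁σ₂ - ∂₂σ₁` of `σ` in `U`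
(here `fderiv ℝ φ x !₂[σ₂, -σ₁]` is `σ₂ ∂₁φ - σ₁ ∂₂φ`). -/
def HasWeakRot (U : Set Plane) (σ : Plane → Plane) (r : Plane → ℝ) : Prop :=
  ∀ φ, IsTest U φ →
    ∫ x in U, fderiv ℝ φ x !₂[σ x 1, -(σ x 0)] = - ∫ x in U, r x * φ x

/-- The space `H(div; U)`. -/
def MemHdiv (U : Set Plane) (σ : Plane → Plane) : Prop :=
  MemLp σ 2 (volume.restrict U) ∧ ∃ d, MemLp d 2 (volume.restrict U) ∧ HasWeakDiv U σ d

/-- The space `H(rot; U)`. -/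
def MemHrot (U : Set Plane) (σ : Plane → Plane) : Prop :=
  MemLp σ 2 (volume.restrict U) ∧ ∃ r, MemLp r 2 (volume.restrict U) ∧ HasWeakRot U σ r

/-! ### Polygons and meshes -/

/-- Arc length on the segment with end points `a` and `b`. -/
def arcLength (a b : Plane) : Measure Plane :=
  (Measure.hausdorffMeasure 1).restrict (segment ℝ a b)

/-- A polygonal element, that is, an open polygon with its list of vertices: a nonempty bounded open set whose boundary is a simple closed polygonal curve.
Its vertices are listed counterclockwise, cyclically (the addition in `Fin (m + 3)` is modulo
`m + 3`). Straight angles are allowed, so that a hanging node counts as a vertex. -/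
structure Element where
  m : ℕ
  vertex : Fin (m + 3) → Plane
  carrier : Set Plane
  isOpen : IsOpen carrier
  isBounded : Bornology.IsBounded carrier
  nonempty : carrier.Nonempty
  injective : Function.Injective vertex
  simple : ∀ i j, i ≠ j → ∀ x ∈ segment ℝ (vertex i) (vertex (i + 1)),
    x ∈ segment ℝ (vertex j) (vertex (j + 1)) →
      (j = i + 1 ∧ x = vertex j) ∨ (i = j + 1 ∧ x = vertex i)
  frontier_eq : frontier carrier = ⋃ i, segment ℝ (vertex i) (vertex (i + 1))
  counterclockwise :
    0 < ∑ i, (vertex i 0 * vertex (i + 1) 1 - vertex (i + 1) 0 * vertex i 1)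

namespace Element

/-- The edges of `K` are indexed by `Fin (K.m + 3)`; this is the arc length measure on the edge
from `vertex i` to `vertex (i + 1)`. -/
def edgeMeasure (K : Element) (i : Fin (K.m + 3)) : Measure Plane :=
  arcLength (K.vertex i) (K.vertex (i + 1))

/-- The length of an edge. -/
def edgeLength (K : Element) (i : Fin (K.m + 3)) : ℝ :=
  dist (K.vertex i) (K.vertex (i + 1))

/-- The unit normal of an edge that points out of `K`: the edge is run through counterclockwise,
and its unit tangent is turned by a right angle to the right. -/
def normal (K : Element) (i : Fin (K.m + 3)) : Plane :=
  (K.edgeLength i)⁻¹ •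
    !₂[K.vertex (i + 1) 1 - K.vertex i 1, K.vertex i 0 - K.vertex (i + 1) 0]

/-- Shape regularity with constant `C`: every edge is longer than `C` times the diameter, and the
polygon is star-shaped with respect to every point of a ball with radius `C` times the diameter. -/
def IsRegular (K : Element) (C : ℝ) : Prop :=
  (∀ i, C * Metric.diam K.carrier < K.edgeLength i) ∧
    ∃ z ∈ K.carrier, ∀ y ∈ Metric.ball z (C * Metric.diam K.carrier), StarConvex ℝ y K.carrier

end Element

/-- A bounded domain whose boundary consists of finitely many segments. -/
structure IsPolygonalDomain (Ω : Set Plane) : Prop where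
  isOpen : IsOpen Ω
  isBounded : Bornology.IsBounded Ω
  isConnected : IsConnected Ω
  polygonal : ∃ S : Set (Plane × Plane), S.Finite ∧ frontier Ω = ⋃ s ∈ S, segment ℝ s.1 s.2

/-- A decomposition of `Ω` into finitely many open non-overlapping polygons. -/
structure Mesh (Ω : Set Plane) where
  elements : Set Element
  finite : elements.Finite
  subset : ∀ K ∈ elements, K.carrier ⊆ Ω
  disjoint : elements.PairwiseDisjoint Element.carrier
  cover : closure Ω = ⋃ K ∈ elements, closure K.carrier

/-- All elements of the mesh are shape regular with constant `C`. -/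
def Mesh.IsRegular {Ω : Set Plane} (T : Mesh Ω) (C : ℝ) : Prop :=
  ∀ K ∈ T.elements, K.IsRegular C

/-! ### Traces -/

/-- `g` is the trace on the `i`-th edge of `K` of the scalar function `u ∈ H¹(K)`: it is the limit
in `L²` of the edge of the restrictions of smooth functions that tend to `u` in `H¹(K)`. -/
def IsTrace (K : Element) (i : Fin (K.m + 3)) (u g : Plane → ℝ) : Prop :=
  MemLp g 2 (K.edgeMeasure i) ∧
    ∃ (G : Plane → Plane) (w : ℕ → Plane → ℝ), IsH1 K.carrier u G ∧
      (∀ n, ContDiff ℝ ∞ (w n)) ∧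
      Tendsto (fun n => eLpNorm (fun x => w n x - u x) 2 (volume.restrict K.carrier))
        atTop (𝓝 0) ∧
      Tendsto (fun n => eLpNorm (fun x => gradient (w n) x - G x) 2 (volume.restrict K.carrier))
        atTop (𝓝 0) ∧
      Tendsto (fun n => eLpNorm (fun x => w n x - g x) 2 (K.edgeMeasure i)) atTop (𝓝 0)

/-- `t` is the trace on the `i`-th edge of `K` of the vector field `τ ∈ [H¹(K)]²`. -/
def IsVecTrace (K : Element) (i : Fin (K.m + 3)) (τ t : Plane → Plane) : Prop :=
  ∀ j, IsTrace K i (fun x => τ x j) (fun x => t x j)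

/-- The normal component of `σ ∈ H(div; K)` on the boundary of `K`, with respect to the outward
unit normal, is the square integrable function `g`. As usual for `H(div; K)`, it is defined by
Green's formula. -/
def IsNormalTrace (K : Element) (σ : Plane → Plane) (g : Plane → ℝ) : Prop :=
  MemLp σ 2 (volume.restrict K.carrier) ∧ (∀ i, MemLp g 2 (K.edgeMeasure i)) ∧
    ∃ d, MemLp d 2 (volume.restrict K.carrier) ∧ HasWeakDiv K.carrier σ d ∧
      ∀ φ : Plane → ℝ, ContDiff ℝ ∞ φ → HasCompactSupport φ →
        (∫ x in K.carrier, fderiv ℝ φ x (σ x)) + ∫ x in K.carrier, d x * φ x =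
          ∑ i, ∫ x, g x * φ x ∂(K.edgeMeasure i)

/-! ### The virtual element space and its interpolation -/

/-- The local virtual element space of order `k` on `K`: the fields in `H(div; K) ∩ H(rot; K)` with
normal component in `P_k` on each edge, divergence in `P_k(K)` and rotation in `P_{k-1}(K)`. -/
structure MemLocalSpace (k : ℕ) (K : Element) (σ : Plane → Plane) : Prop where
  hdiv : MemHdiv K.carrier σ
  hrot : MemHrot K.carrier σ
  normal : ∃ g, IsNormalTrace K σ g ∧
    ∀ i, ∃ p, IsPoly k p ∧ g =ᵐ[K.edgeMeasure i] p
  div_poly : ∃ d, IsPoly k d ∧ HasWeakDiv K.carrier σ d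
  rot_poly : ∃ r, IsPoly ((k : ℤ) - 1) r ∧ HasWeakRot K.carrier σ r

/-- The global virtual element space: fields in `H(div; Ω)` that lie in the local space on every
element. No boundary condition is imposed. -/
def MemSpace {Ω : Set Plane} (k : ℕ) (T : Mesh Ω) (σ : Plane → Plane) : Prop :=
  MemHdiv Ω σ ∧ ∀ K ∈ T.elements, MemLocalSpace k K σ

/-- `σ` is the interpolant of `τ` in the virtual element space: it lies in the space and has the
same degrees of freedom as `τ`. These are the moments of the normal component against `P_k` on the
edges, and on each element the moments against the gradients of `P_k` and against the fields in
`[P_k]²` that are `L²`-orthogonal to the gradients of `P_{k+1}`. -/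
structure IsInterpolant {Ω : Set Plane} (k : ℕ) (T : Mesh Ω) (τ σ : Plane → Plane) : Prop where
  mem : MemSpace k T σ
  edge_moments : ∀ K ∈ T.elements, ∀ i t g, IsVecTrace K i τ t → IsNormalTrace K σ g →
    ∀ q, IsPoly k q →
      ∫ x, q x * g x ∂(K.edgeMeasure i) = ∫ x, q x * ⟪t x, K.normal i⟫ ∂(K.edgeMeasure i)
  gradient_moments : ∀ K ∈ T.elements, ∀ q, IsPoly k q →
    ∫ x in K.carrier, ⟪σ x, gradient q x⟫ = ∫ x in K.carrier, ⟪τ x, gradient q x⟫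
  orthogonal_moments : ∀ K ∈ T.elements, ∀ η : Plane → Plane, (∀ j, IsPoly k (fun x => η x j)) →
    (∀ p, IsPoly ((k : ℤ) + 1) p → ∫ x in K.carrier, ⟪η x, gradient p x⟫ = 0) →
    ∫ x in K.carrier, ⟪σ x, η x⟫ = ∫ x in K.carrier, ⟪τ x, η x⟫

end MixedVEM

end

noncomputable section

namespace MixedVEM

open scoped ENNReal

/-! ### Star-shaped sets -/

/-! On an edge `e` the function `τI · ν` is a polynomial of degree at most `k`, and the edge moments
make `(τ - τI) · ν` orthogonal to all such polynomials. Hence `τI · ν` is the `L²(e)` projection of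
`τ · ν`, and since `k ≥ 0` the error is at most `‖τ · ν - r‖` for every constant `r`. This is why
the final constant does not see `k`. Taking `r = c · ν` with a constant vector `c` reduces the lemma
to a scalar trace inequality: some constant is within `(3 / C) √h_e |u|_{1,K}` of the trace of `u`
in `L²(e)` (`IsTrace.exists_eLpNorm_sub_le`, up to an arbitrarily small `ε`).

For smooth `u`, let `a`, `b` be the ends of `e` and `z` the centre of the ball. The triangle `abz`
lies in `K` except for the side `ab`. From two points of `ab`, the lines parallel to `az` and to
`bz` meet inside the triangle, so the difference of the values of `u` is controlled by integrals of
its gradient along two segments. Parallel lines sweep the plane with constant Jacobian, so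
integrating over the two points gives an area integral without a singular weight
(`lintegral_lintegral_enorm_sub_sq_le`). The Jacobian `|det₂ (b - a) (z - a)|` is bounded below
because the line `ab` cannot cut the ball (`abs_det₂_ge_of_starConvex_ball`).

Smooth functions are dense in `H¹(K)`: shrink towards `z`, then mollify
(`exists_contDiff_tendsto_of_isH1`). With a trace bound by the full `H¹` norm this gives existence
of traces (`exists_isTrace`), and it carries the inequality over to `H¹`. Green's formula determines
the normal component almost everywhere on each edge (`IsNormalTrace.ae_eq`), so every normal trace
of `τI` is the polynomial supplied by the local space. -/

theorem combo_mem_of_starConvex_ball {U : Set Plane} {z : Plane} {ρ : ℝ}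
    (hU : ∀ y ∈ Metric.ball z ρ, StarConvex ℝ y U) {x y : Plane} (hx : x ∈ closure U)
    (hy : y ∈ Metric.ball z ρ) {s : ℝ} (hs0 : 0 < s) (hs1 : s ≤ 1) :
    (1 - s) • x + s • y ∈ U := by
  -- Replace `x` by a nearby `w` in `U` and move `y` to compensate. The moved point stays in the
  -- open ball, and its combination with `w` is the original point.
  have hcont : ContinuousAt (fun w : Plane => y + s⁻¹ • ((1 - s) • (x - w))) x := by
    fun_prop
  have h0 : (fun w : Plane => y + s⁻¹ • ((1 - s) • (x - w))) x ∈ Metric.ball z ρ := by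
    simpa using hy
  have h1 := hcont.preimage_mem_nhds (Metric.isOpen_ball.mem_nhds h0)
  obtain ⟨w, hw1, hw2⟩ := mem_closure_iff_nhds.1 hx _ h1
  have h2 := (hU _ hw1).add_smul_sub_mem hw2 (sub_nonneg.2 hs1) (by linarith : 1 - s ≤ 1)
  convert h2 using 1
  have : s • (s⁻¹ • ((1 - s) • (x - w))) = (1 - s) • (x - w) := by
    rw [smul_smul, mul_inv_cancel₀ hs0.ne', one_smul]
  have e : y + s⁻¹ • ((1 - s) • (x - w)) +
      (1 - s) • (w - (y + s⁻¹ • ((1 - s) • (x - w)))) =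
      s • y + s • (s⁻¹ • ((1 - s) • (x - w))) + (1 - s) • w := by module
  rw [e, this]
  module

/-- The determinant of two vectors of the plane. -/
def det₂ (u v : Plane) : ℝ := u 0 * v 1 - u 1 * v 0

/-- The determinant divided by `dist a b` is, up to sign, the distance from `z` to the line `ab`. If
it were less than `ρ`, the foot `y` of the perpendicular would lie in the ball. Then `a`, `y` or
`b`, according to the position of `y` on the line, would be a point of the segment that is a
combination of `y`, with positive weight, and a point of `closure U`. Such a point is in the open
set `U`, hence not on its frontier. -/
theorem abs_det₂_ge_of_starConvex_ball {U : Set Plane} (hUo : IsOpen U) {z : Plane} {ρ : ℝ}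
    (hU : ∀ y ∈ Metric.ball z ρ, StarConvex ℝ y U) {a b : Plane} (hab : a ≠ b)
    (hseg : segment ℝ a b ⊆ frontier U) : dist a b * ρ ≤ |det₂ (b - a) (z - a)| := by
  by_contra! hlt
  have hd : 0 < dist a b := dist_pos.2 hab
  have hnot : ∀ x ∈ segment ℝ a b, x ∉ U := fun x hx hxU =>
    (hseg hx).2 (by rwa [hUo.interior_eq])
  have hcl : ∀ x ∈ segment ℝ a b, x ∈ closure U := fun x hx => frontier_subset_closure (hseg hx)
  set D := dist a b with hD
  have hDsq : D ^ 2 = (b 0 - a 0) ^ 2 + (b 1 - a 1) ^ 2 := by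
    rw [hD, dist_comm, EuclideanSpace.dist_eq, Real.sq_sqrt (by positivity)]
    simp [Fin.sum_univ_two, Real.dist_eq, sq_abs]
  set δ := det₂ (b - a) (z - a) with hδ
  set t : ℝ := ((b 0 - a 0) * (z 0 - a 0) + (b 1 - a 1) * (z 1 - a 1)) / D ^ 2 with ht
  set y : Plane := a + t • (b - a) with hy
  have hzy : dist y z < ρ := by
    have h1 : dist y z ^ 2 = (δ / D) ^ 2 := by
      rw [EuclideanSpace.dist_eq, Real.sq_sqrt (by positivity)]
      simp only [Fin.sum_univ_two, Real.dist_eq, sq_abs, hy, PiLp.add_apply, PiLp.smul_apply,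
        PiLp.sub_apply, smul_eq_mul, hδ, det₂, ht, div_pow]
      rw [hDsq]
      have : (b 0 - a 0) ^ 2 + (b 1 - a 1) ^ 2 ≠ 0 := by rw [← hDsq]; positivity
      field_simp
      ring
    have h2 : dist y z = |δ| / D := by
      rw [← abs_of_pos hd, ← abs_div, ← abs_of_nonneg (dist_nonneg (x := y) (y := z))]
      exact (sq_eq_sq_iff_abs_eq_abs _ _).1 h1
    rw [h2, div_lt_iff₀ hd, mul_comm]
    exact hlt
  have hyb : y ∈ Metric.ball z ρ := hzy
  rcases lt_or_ge t 0 with h0 | h0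
  · refine hnot a (left_mem_segment ℝ a b) ?_
    have := combo_mem_of_starConvex_ball hU (hcl b (right_mem_segment ℝ a b)) hyb
      (s := 1 / (1 - t)) (by apply one_div_pos.2; linarith)
      (by rw [div_le_one (by linarith)]; linarith)
    convert this using 1
    have ht1 : (1 - t) ≠ 0 := by linarith
    rw [hy]
    ext i
    simp
    field_simp
    ring
  rcases le_or_gt t 1 with h1 | h1
  · have hys : y ∈ segment ℝ a b := by
      rw [segment_eq_image']
      exact ⟨t, ⟨h0, h1⟩, rfl⟩
    refine hnot y hys ?_
    simpa using combo_mem_of_starConvex_ball hU (hcl y hys) hyb zero_lt_one le_rfl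
  · refine hnot b (right_mem_segment ℝ a b) ?_
    have := combo_mem_of_starConvex_ball hU (hcl a (left_mem_segment ℝ a b)) hyb
      (s := 1 / t) (by positivity) (by rw [div_le_one (by linarith)]; linarith)
    convert this using 1
    rw [hy]
    ext i
    simp
    field_simp
    ring

/-! ### Parametrizations -/

/-- Change of variables by the linear map with columns `u` and `v`, together with Tonelli and
translation invariance. -/
theorem lintegral_affine {u v : Plane} (h : det₂ u v ≠ 0) (a : Plane) {F : Plane → ℝ≥0∞}
    (hF : Measurable F) :
    ∫⁻ α : ℝ, ∫⁻ s : ℝ, F (a + α • u + s • v) =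
      ENNReal.ofReal |(det₂ u v)⁻¹| * ∫⁻ x, F x := by
  set M : Matrix (Fin 2) (Fin 2) ℝ := !![u 0, v 0; u 1, v 1] with hM
  set L : Plane →ₗ[ℝ] Plane := Matrix.toLpLin 2 2 M with hL
  have hdet : LinearMap.det L = det₂ u v := by
    rw [hL, Matrix.toLpLin_eq_toLin, LinearMap.det_toLin, hM, Matrix.det_fin_two_of, det₂]
    ring
  have hmap := Measure.map_linearMap_addHaar_eq_smul_addHaar (volume : Measure Plane)
    (f := L) (by rwa [hdet])
  rw [hdet] at hmap
  have hLc : Measurable L := L.continuous_of_finiteDimensional.measurable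
  have hG : Measurable fun x => F (a + x) := hF.comp (measurable_const.add measurable_id)
  have e1 : ∫⁻ x, F (a + x) ∂(Measure.map L volume) =
      ENNReal.ofReal |(det₂ u v)⁻¹| * ∫⁻ x, F x := by
    rw [hmap, lintegral_smul_measure, lintegral_add_left_eq_self F a, smul_eq_mul]
  rw [← e1, lintegral_map hG hLc]
  have e2 := (EuclideanSpace.volume_preserving_symm_measurableEquiv_toLp (Fin 2)).symm
  have e3 := (volume_preserving_finTwoArrow ℝ).symm
  have hH : Measurable fun x => F (a + L x) := hG.comp hLc
  have hH' : Measurable fun x => F (a + L ((MeasurableEquiv.toLp 2 (Fin 2 → ℝ)).symm.symm x)) :=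
    hH.comp e2.measurable
  rw [← e2.lintegral_comp hH, ← e3.lintegral_comp hH',
    Measure.volume_eq_prod, lintegral_prod]
  · refine lintegral_congr fun α => lintegral_congr fun s => ?_
    rw [add_assoc]
    congr 1
    congr 1
    ext i
    fin_cases i <;> simp [hL, hM, Matrix.toLpLin_apply]
  · exact (hH'.comp e3.measurable).aemeasurable

/-- The unit speed parametrization is an isometry, so it carries Lebesgue measure to one-dimensional
Hausdorff measure on the line; rescaling to `[0, 1]` produces the factor `dist a b`. -/
theorem lintegral_arcLength {a b : Plane} (hab : a ≠ b) {F : Plane → ℝ≥0∞} (hF : Measurable F) :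
    ∫⁻ x, F x ∂(arcLength a b) =
      ENNReal.ofReal (dist a b) * ∫⁻ α in Icc (0 : ℝ) 1, F (a + α • (b - a)) := by
  have hd : 0 < dist a b := dist_pos.2 hab
  set p : ℝ → Plane := fun s => a + s • ((dist a b)⁻¹ • (b - a)) with hp
  have hiso : Isometry p := by
    refine Isometry.of_dist_eq fun s t => ?_
    have : a + s • ((dist a b)⁻¹ • (b - a)) - (a + t • ((dist a b)⁻¹ • (b - a))) =
      (s - t) • ((dist a b)⁻¹ • (b - a)) := by module
    rw [hp, dist_eq_norm, dist_eq_norm s t]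
    simp only
    rw [this, norm_smul, norm_smul, ← dist_eq_norm b, dist_comm b a, norm_inv, Real.norm_eq_abs,
      Real.norm_eq_abs, abs_of_pos hd, inv_mul_cancel₀ hd.ne', mul_one]
  have hpm : Measurable p := hiso.continuous.measurable
  have himg : segment ℝ a b = p '' Icc 0 (dist a b) := by
    rw [segment_eq_image']
    ext x
    constructor
    · rintro ⟨θ, ⟨h0, h1⟩, rfl⟩
      refine ⟨θ * dist a b, ⟨by positivity, by nlinarith⟩, ?_⟩
      simp only [hp, smul_smul]
      rw [mul_assoc, mul_inv_cancel₀ hd.ne', mul_one]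
    · rintro ⟨s, ⟨h0, h1⟩, rfl⟩
      refine ⟨s * (dist a b)⁻¹, ⟨by positivity, ?_⟩, ?_⟩
      · rw [← div_eq_mul_inv]; exact (div_le_one hd).2 h1
      · simp only [hp, smul_smul]
  have hpre : p ⁻¹' segment ℝ a b = Icc 0 (dist a b) := by
    rw [himg, preimage_image_eq _ hiso.injective]
  have hmeas : MeasurableSet (segment ℝ a b) := by
    rw [himg]; exact (isCompact_Icc.image hiso.continuous).measurableSet
  have hmap := hiso.map_hausdorffMeasure (d := 1) (Or.inl zero_le_one)
  rw [hausdorffMeasure_real] at hmap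
  have harc : arcLength a b = Measure.map p (volume.restrict (Icc 0 (dist a b))) := by
    rw [← hpre, ← Measure.restrict_map hpm hmeas, hmap, Measure.restrict_restrict hmeas,
      inter_eq_left.2, arcLength]
    rw [himg]; exact image_subset_range _ _
  have hscale := Real.smul_map_volume_mul_left hd.ne'
  rw [harc, lintegral_map hF hpm, ← lintegral_indicator measurableSet_Icc,
    ← lintegral_indicator measurableSet_Icc]
  have hm : Measurable ((Icc 0 (dist a b)).indicator fun s => F (p s)) :=
    (hF.comp hpm).indicator measurableSet_Icc
  conv_lhs => rw [← hscale]
  rw [lintegral_smul_measure, lintegral_map hm (measurable_const_mul _), abs_of_pos hd, smul_eq_mul]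
  congr 1
  refine lintegral_congr fun s => ?_
  have hiff : dist a b * s ∈ Icc 0 (dist a b) ↔ s ∈ Icc (0 : ℝ) 1 := by
    constructor
    · rintro ⟨h0, h1⟩
      exact ⟨by by_contra! h; nlinarith, by by_contra! h; nlinarith⟩
    · rintro ⟨h0, h1⟩
      exact ⟨by positivity, by nlinarith⟩
  by_cases hs : s ∈ Icc (0 : ℝ) 1
  · rw [indicator_of_mem (hiff.2 hs), indicator_of_mem hs]
    simp only [hp, smul_smul]
    rw [mul_comm (dist a b), mul_assoc, mul_inv_cancel₀ hd.ne', mul_one]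
  · rw [indicator_of_notMem (fun h => hs (hiff.1 h)), indicator_of_notMem hs]

end MixedVEM

namespace MixedVEM

open scoped ENNReal

/-! ### Trace inequalities for smooth functions -/

theorem eLpNorm_two_sq {α E : Type*} [MeasurableSpace α] [NormedAddCommGroup E] (f : α → E)
    (μ : Measure α) : eLpNorm f 2 μ ^ 2 = ∫⁻ x, ‖f x‖ₑ ^ 2 ∂μ := by
  have := eLpNorm_nnreal_pow_eq_lintegral (f := f) (μ := μ) (p := 2) two_ne_zero
  simpa using this

theorem lintegral_sq_le {α : Type*} [MeasurableSpace α] (μ : Measure α) {f : α → ℝ≥0∞}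
    (hf : AEMeasurable f μ) : (∫⁻ x, f x ∂μ) ^ 2 ≤ μ univ * ∫⁻ x, f x ^ 2 ∂μ := by
  have h := ENNReal.lintegral_mul_le_Lp_mul_Lq μ (p := 2) (q := 2)
    (Real.holderConjugate_iff.2 ⟨by norm_num, by norm_num⟩) (f := fun _ => 1)
    aemeasurable_const hf
  simp only [Pi.mul_apply, one_mul, ENNReal.one_rpow, lintegral_const] at h
  have h2 := pow_le_pow_left' h 2
  refine h2.trans_eq ?_
  rw [mul_pow, ← ENNReal.rpow_natCast, ← ENNReal.rpow_natCast, ← ENNReal.rpow_mul,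
    ← ENNReal.rpow_mul]
  simp

theorem add_sq_le_two_mul (a b : ℝ≥0∞) : (a + b) ^ 2 ≤ 2 * a ^ 2 + 2 * b ^ 2 := by
  have := ENNReal.rpow_add_le_mul_rpow_add_rpow a b (p := 2) (by norm_num)
  norm_num [mul_add] at this
  exact this

/-- Fundamental theorem of calculus along the segment, then Cauchy–Schwarz; the length `t ≤ 1` of
the parameter interval is dropped. -/
theorem enorm_sub_sq_le {f : Plane → ℝ} (hf : ContDiff ℝ ∞ f) (x v : Plane) {t : ℝ} (ht0 : 0 ≤ t)
    (ht1 : t ≤ 1) :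
    ‖f (x + t • v) - f x‖ₑ ^ 2 ≤ ‖v‖ₑ ^ 2 * ∫⁻ s in Ioc 0 t, ‖gradient f (x + s • v)‖ₑ ^ 2 := by
  have hfd : Differentiable ℝ f := hf.differentiable (by simp)
  have hgc : Continuous (gradient f) :=
    (InnerProductSpace.toDual ℝ Plane).symm.continuous.comp (hf.continuous_fderiv (by simp))
  have hline : Continuous fun s : ℝ => gradient f (x + s • v) := hgc.comp (by fun_prop)
  have hder : ∀ s : ℝ, HasDerivAt (fun s : ℝ => f (x + s • v)) (⟪gradient f (x + s • v), v⟫) s := by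
    intro s
    have h1 : HasDerivAt (fun s : ℝ => x + s • v) v s := by
      simpa using ((hasDerivAt_id s).smul_const v).const_add x
    have h2 := (hfd (x + s • v)).hasFDerivAt.comp_hasDerivAt s h1
    have e : ⟪gradient f (x + s • v), v⟫ = fderiv ℝ f (x + s • v) v := by simp [gradient]
    rw [e]
    exact h2
  have hint : ∫ s in (0:ℝ)..t, ⟪gradient f (x + s • v), v⟫ = f (x + t • v) - f x := by
    rw [intervalIntegral.integral_eq_sub_of_hasDerivAt (fun s _ => hder s)]
    · simp
    · exact (hline.inner continuous_const).intervalIntegrable _ _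
  have h1 : ‖f (x + t • v) - f x‖ₑ ≤ ∫⁻ s in Ioc 0 t, ‖v‖ₑ * ‖gradient f (x + s • v)‖ₑ := by
    rw [← hint, intervalIntegral.integral_of_le ht0]
    refine (enorm_integral_le_lintegral_enorm _).trans (lintegral_mono fun s => ?_)
    rw [mul_comm, ← ofReal_norm, ← ofReal_norm, ← ofReal_norm,
      ← ENNReal.ofReal_mul (norm_nonneg _)]
    exact ENNReal.ofReal_le_ofReal (norm_inner_le_norm _ _)
  have hm : Measurable fun s : ℝ => ‖gradient f (x + s • v)‖ₑ := hline.measurable.enorm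
  rw [lintegral_const_mul _ hm] at h1
  calc _ ≤ (‖v‖ₑ * ∫⁻ s in Ioc 0 t, ‖gradient f (x + s • v)‖ₑ) ^ 2 := pow_le_pow_left' h1 2
    _ = ‖v‖ₑ ^ 2 * (∫⁻ s in Ioc 0 t, ‖gradient f (x + s • v)‖ₑ) ^ 2 := mul_pow _ _ _
    _ ≤ _ := by
      gcongr
      refine (lintegral_sq_le _ hm.aemeasurable).trans ?_
      rw [Measure.restrict_apply_univ, Real.volume_Ioc, sub_zero]
      exact mul_le_of_le_one_left' (ENNReal.ofReal_le_one.2 ht1)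

theorem measurable_gradient {f : Plane → ℝ} (hf : ContDiff ℝ ∞ f) : Measurable (gradient f) :=
  ((InnerProductSpace.toDual ℝ Plane).symm.continuous.comp
    (hf.continuous_fderiv (by simp))).measurable

/-- The integrals of a function over the segments that are parallel to the side `az` of the triangle
with vertices `a`, `b` and `z` add up to its integral over the plane. -/
theorem lintegral_Icc_lintegral_affine_le {u v : Plane} (h : det₂ u v ≠ 0) (a : Plane)
    {F : Plane → ℝ≥0∞} (hF : Measurable F) (S : Set ℝ) :
    ∫⁻ α in S, ∫⁻ s : ℝ, F (a + α • u + s • v) ≤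
      ENNReal.ofReal |(det₂ u v)⁻¹| * ∫⁻ x, F x :=
  (lintegral_mono' Measure.restrict_le_self le_rfl).trans_eq (lintegral_affine h a hF)

/-- The indicator lets `s` run over the whole line, the form to which `lintegral_affine` applies. -/
theorem enorm_sub_sq_le_lintegral_indicator {U : Set Plane} {f : Plane → ℝ} (hf : ContDiff ℝ ∞ f)
    {x v : Plane} {t : ℝ} (h0 : 0 ≤ t) (h1 : t ≤ 1) (hs : ∀ s, 0 < s → s ≤ t → x + s • v ∈ U)
    {D : ℝ≥0∞} (hv : ‖v‖ₑ ≤ D) :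
    ‖f (x + t • v) - f x‖ₑ ^ 2 ≤
      D ^ 2 * ∫⁻ s : ℝ, U.indicator (fun x => ‖gradient f x‖ₑ ^ 2) (x + s • v) := by
  refine (enorm_sub_sq_le hf x v h0 h1).trans (mul_le_mul' (pow_le_pow_left' hv 2) ?_)
  refine (setLIntegral_mono' measurableSet_Ioc fun s hs' => ?_).trans
    (setLIntegral_le_lintegral (Ioc 0 t) _)
  rw [indicator_of_mem (hs s hs'.1 hs'.2)]

variable {U : Set Plane} {a b z : Plane}

/-- If the triangle with vertices `a`, `b` and `z`, apart from the side `ab`, lies in `U`, then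
the oscillation of a smooth function on `ab` is bounded by its gradient in `U`. -/
theorem lintegral_lintegral_enorm_sub_sq_le (hU : MeasurableSet U)
    (htri : ∀ α s : ℝ, 0 ≤ α → 0 < s → α + s ≤ 1 → a + α • (b - a) + s • (z - a) ∈ U)
    (hdet : det₂ (b - a) (z - a) ≠ 0) {D : ℝ≥0∞} (hza : ‖z - a‖ₑ ≤ D) (hzb : ‖z - b‖ₑ ≤ D)
    {f : Plane → ℝ} (hf : ContDiff ℝ ∞ f) :
    ∫⁻ α in Icc (0:ℝ) 1, ∫⁻ β in Icc (0:ℝ) 1,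
        ‖f (a + β • (b - a)) - f (a + α • (b - a))‖ₑ ^ 2 ≤
      8 * D ^ 2 * ENNReal.ofReal |(det₂ (b - a) (z - a))⁻¹| * ∫⁻ x in U, ‖gradient f x‖ₑ ^ 2 := by
  set F : Plane → ℝ≥0∞ := U.indicator fun x => ‖gradient f x‖ₑ ^ 2 with hFdef
  have hF : Measurable F := ((measurable_gradient hf).enorm.pow_const 2).indicator hU
  set p : ℝ → Plane := fun α => a + α • (b - a) with hp
  set A : ℝ → ℝ≥0∞ := fun α => ∫⁻ s : ℝ, F (a + α • (b - a) + s • (z - a)) with hA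
  set B : ℝ → ℝ≥0∞ := fun α => ∫⁻ s : ℝ, F (a + α • (b - a) + s • (z - b)) with hB
  have hAm : Measurable A := by
    apply Measurable.lintegral_prod_right'
      (f := fun q : ℝ × ℝ => F (a + q.1 • (b - a) + q.2 • (z - a)))
    exact hF.comp (by fun_prop)
  have hBm : Measurable B := by
    apply Measurable.lintegral_prod_right'
      (f := fun q : ℝ × ℝ => F (a + q.1 • (b - a) + q.2 • (z - b)))
    exact hF.comp (by fun_prop)
  have step : ∀ α β : ℝ, 0 ≤ α → α ≤ β → β ≤ 1 →
      ‖f (p β) - f (p α)‖ₑ ^ 2 ≤ 2 * D ^ 2 * (A α + B β) := by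
    intro α β h0 h1 h2
    -- The meeting point of the parallel to `az` through `p α` and the parallel to `bz` through `p
    -- β`; both are reached at the same parameter `β - α`.
    have e : p β + (β - α) • (z - b) = p α + (β - α) • (z - a) := by
      simp only [hp]; module
    have k1 := enorm_sub_sq_le_lintegral_indicator hf (x := p α) (v := z - a)
      (t := β - α) (by linarith) (by linarith) (fun s hs0 hs1 => htri α s h0 hs0 (by linarith)) hza
    have k2 := enorm_sub_sq_le_lintegral_indicator hf (x := p β) (v := z - b)
      (t := β - α) (by linarith) (by linarith) (fun s hs0 hs1 => by
        -- In the coordinates based at `a`, the point `p β + s • (z - b)` has coefficients `β - s`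
        -- and `s`, whose sum is `β ≤ 1`.
        have := htri (β - s) s (by linarith) hs0 (by linarith)
        convert this using 1
        simp only [hp]; module) hzb
    rw [e] at k2
    set w := f (p α + (β - α) • (z - a))
    have : ‖f (p β) - f (p α)‖ₑ ≤ ‖w - f (p α)‖ₑ + ‖w - f (p β)‖ₑ := by
      have : f (p β) - f (p α) = (w - f (p α)) - (w - f (p β)) := by ring
      rw [this]
      exact enorm_sub_le
    calc _ ≤ (‖w - f (p α)‖ₑ + ‖w - f (p β)‖ₑ) ^ 2 := pow_le_pow_left' this 2
      _ ≤ _ := add_sq_le_two_mul _ _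
      _ ≤ 2 * (D ^ 2 * A α) + 2 * (D ^ 2 * B β) := by gcongr
      _ = _ := by ring
  have bound : ∀ α ∈ Icc (0:ℝ) 1, ∀ β ∈ Icc (0:ℝ) 1,
      ‖f (p β) - f (p α)‖ₑ ^ 2 ≤ 2 * D ^ 2 * ((A α + B α) + (A β + B β)) := by
    intro α hα β hβ
    rcases le_total α β with h | h
    · refine (step α β hα.1 h hβ.2).trans ?_
      gcongr
      · exact le_self_add
      · exact le_add_self
    · rw [← enorm_neg, neg_sub]
      refine (step β α hβ.1 h hα.2).trans ?_
      rw [add_comm (A α + B α)]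
      gcongr
      · exact le_self_add
      · exact le_add_self
  have hdet' : det₂ (b - a) (z - b) = det₂ (b - a) (z - a) := by
    simp only [det₂, PiLp.sub_apply]; ring
  set I : ℝ≥0∞ := ENNReal.ofReal |(det₂ (b - a) (z - a))⁻¹| * ∫⁻ x in U, ‖gradient f x‖ₑ ^ 2 with hI
  have hFI : ∫⁻ x, F x = ∫⁻ x in U, ‖gradient f x‖ₑ ^ 2 := lintegral_indicator hU _
  have hAI : ∫⁻ α in Icc (0:ℝ) 1, A α ≤ I := by
    have := lintegral_Icc_lintegral_affine_le hdet a hF (Icc 0 1)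
    rwa [hFI] at this
  have hBI : ∫⁻ α in Icc (0:ℝ) 1, B α ≤ I := by
    have := lintegral_Icc_lintegral_affine_le (v := z - b) (by rwa [hdet']) a hF (Icc 0 1)
    rwa [hFI, hdet'] at this
  have hABI : ∫⁻ α in Icc (0:ℝ) 1, (A α + B α) ≤ 2 * I := by
    rw [lintegral_add_left hAm, two_mul]
    exact add_le_add hAI hBI
  have hABm : Measurable fun α => A α + B α := hAm.add hBm
  calc _ ≤ ∫⁻ α in Icc (0:ℝ) 1, ∫⁻ β in Icc (0:ℝ) 1,
          2 * D ^ 2 * ((A α + B α) + (A β + B β)) :=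
        setLIntegral_mono' measurableSet_Icc fun α hα =>
          setLIntegral_mono' measurableSet_Icc fun β hβ => bound α hα β hβ
    _ = 2 * D ^ 2 * ((∫⁻ α in Icc (0:ℝ) 1, (A α + B α)) + ∫⁻ α in Icc (0:ℝ) 1, (A α + B α)) := by
        have e : ∀ α, ∫⁻ β in Icc (0:ℝ) 1, 2 * D ^ 2 * ((A α + B α) + (A β + B β)) =
            2 * D ^ 2 * ((A α + B α) + ∫⁻ β in Icc (0:ℝ) 1, (A β + B β)) := by
          intro α
          rw [lintegral_const_mul _ (hABm.const_add _), lintegral_add_left measurable_const,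
            setLIntegral_const]
          simp
        simp_rw [e]
        rw [lintegral_const_mul _ (hABm.add_const _), lintegral_add_left hABm,
          setLIntegral_const]
        simp
    _ ≤ 2 * D ^ 2 * (2 * I + 2 * I) := by
        gcongr 2 * D ^ 2 * ?_
        exact add_le_add hABI hABI
    _ = _ := by rw [hI]; ring

/-- The constant is a value of `f` at a point of the edge where the mean square deviation does not
exceed its average over all base points. -/
theorem exists_lintegral_arcLength_enorm_sub_sq_le (hU : MeasurableSet U) (hab : a ≠ b)
    (htri : ∀ α s : ℝ, 0 ≤ α → 0 < s → α + s ≤ 1 → a + α • (b - a) + s • (z - a) ∈ U)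
    (hdet : det₂ (b - a) (z - a) ≠ 0) {D : ℝ≥0∞} (hza : ‖z - a‖ₑ ≤ D) (hzb : ‖z - b‖ₑ ≤ D)
    {f : Plane → ℝ} (hf : ContDiff ℝ ∞ f) :
    ∃ c : ℝ, ∫⁻ x, ‖f x - c‖ₑ ^ 2 ∂(arcLength a b) ≤
      ENNReal.ofReal (dist a b) * (8 * D ^ 2 * ENNReal.ofReal |(det₂ (b - a) (z - a))⁻¹| *
        ∫⁻ x in U, ‖gradient f x‖ₑ ^ 2) := by
  have hfm := hf.continuous.measurable
  have : IsProbabilityMeasure ((volume : Measure ℝ).restrict (Icc 0 1)) := ⟨by simp⟩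
  obtain ⟨α, hα⟩ := exists_le_lintegral (μ := (volume : Measure ℝ).restrict (Icc 0 1))
    (f := fun α : ℝ => ∫⁻ β in Icc (0:ℝ) 1, ‖f (a + β • (b - a)) - f (a + α • (b - a))‖ₑ ^ 2)
    (by
      apply Measurable.aemeasurable
      apply Measurable.lintegral_prod_right'
        (f := fun q : ℝ × ℝ => ‖f (a + q.2 • (b - a)) - f (a + q.1 • (b - a))‖ₑ ^ 2)
      exact (((hfm.comp (by fun_prop)).sub (hfm.comp (by fun_prop))).enorm).pow_const 2)
  refine ⟨f (a + α • (b - a)), ?_⟩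
  rw [lintegral_arcLength hab (F := fun x => ‖f x - f (a + α • (b - a))‖ₑ ^ 2)
    ((hfm.sub measurable_const).enorm.pow_const 2)]
  gcongr
  exact hα.trans (lintegral_lintegral_enorm_sub_sq_le hU htri hdet hza hzb hf)

/-- A qualitative trace bound, needed only for the existence of traces, so `M` may depend on the
triangle and is not optimized. Averaging along segments into the triangle bounds `f` on the half of
the edge next to `a`; the oscillation bound extends this to the whole edge. -/
theorem lintegral_arcLength_enorm_sq_le (hU : MeasurableSet U) (hab : a ≠ b)
    (htri : ∀ α s : ℝ, 0 ≤ α → 0 < s → α + s ≤ 1 → a + α • (b - a) + s • (z - a) ∈ U)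
    (hdet : det₂ (b - a) (z - a) ≠ 0) :
    ∃ M : ℝ≥0∞, M ≠ ⊤ ∧ ∀ f : Plane → ℝ, ContDiff ℝ ∞ f →
      ∫⁻ x, ‖f x‖ₑ ^ 2 ∂(arcLength a b) ≤
        M * ((∫⁻ x in U, ‖f x‖ₑ ^ 2) + ∫⁻ x in U, ‖gradient f x‖ₑ ^ 2) := by
  set D : ℝ≥0∞ := ‖z - a‖ₑ + ‖z - b‖ₑ with hD
  set J : ℝ≥0∞ := ENNReal.ofReal |(det₂ (b - a) (z - a))⁻¹| with hJ
  refine ⟨ENNReal.ofReal (dist a b) * (48 * (1 + D ^ 2) * J),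
    by simp [hD, hJ, ENNReal.mul_eq_top], fun f hf => ?_⟩
  have hfm := hf.continuous.measurable
  set F : Plane → ℝ≥0∞ := U.indicator fun x => ‖gradient f x‖ₑ ^ 2 with hFdef
  have hF : Measurable F := ((measurable_gradient hf).enorm.pow_const 2).indicator hU
  set F₀ : Plane → ℝ≥0∞ := U.indicator fun x => ‖f x‖ₑ ^ 2 with hF₀def
  have hF₀ : Measurable F₀ := (hfm.enorm.pow_const 2).indicator hU
  set X : ℝ≥0∞ := ∫⁻ x in U, ‖f x‖ₑ ^ 2 with hX
  set Y : ℝ≥0∞ := ∫⁻ x in U, ‖gradient f x‖ₑ ^ 2 with hY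
  have hFY : ∫⁻ x, F x = Y := lintegral_indicator hU _
  have hFX : ∫⁻ x, F₀ x = X := lintegral_indicator hU _
  set p : ℝ → Plane := fun α => a + α • (b - a) with hp
  have hpm : Measurable p := by fun_prop
  set A : ℝ → ℝ≥0∞ := fun α => ∫⁻ s : ℝ, F (a + α • (b - a) + s • (z - a)) with hA
  set A₀ : ℝ → ℝ≥0∞ := fun α => ∫⁻ s : ℝ, F₀ (a + α • (b - a) + s • (z - a)) with hA₀
  have hAm : Measurable A := by
    apply Measurable.lintegral_prod_right'
      (f := fun q : ℝ × ℝ => F (a + q.1 • (b - a) + q.2 • (z - a)))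
    exact hF.comp (by fun_prop)
  have hhalf : ∀ x : ℝ≥0∞, x = 2 * (x * ENNReal.ofReal (1 / 2)) := by
    intro x
    rw [mul_left_comm, one_div, ENNReal.ofReal_inv_of_pos two_pos, ENNReal.ofReal_ofNat,
      ENNReal.mul_inv_cancel two_ne_zero ENNReal.ofNat_ne_top, mul_one]
  -- For `β ≤ 1 / 2` all steps `s ≤ 1 / 2` stay in the triangle; averaging over them replaces the
  -- value at the far end by a line integral of `f ^ 2`.
  have hinner : ∀ β ∈ Icc (0:ℝ) (1 / 2), ‖f (p β)‖ₑ ^ 2 ≤ 4 * A₀ β + 2 * (D ^ 2 * A β) := by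
    intro β hβ
    have h1 : ∀ s ∈ Ioc (0:ℝ) (1 / 2),
        ‖f (p β)‖ₑ ^ 2 ≤ 2 * F₀ (p β + s • (z - a)) + 2 * (D ^ 2 * A β) := by
      intro s hs
      have hmem : ∀ r, 0 < r → r ≤ s → p β + r • (z - a) ∈ U := fun r h0 h1 =>
        htri β r hβ.1 h0 (by linarith [hβ.2, hs.2])
      have k := enorm_sub_sq_le_lintegral_indicator hf hs.1.le (by linarith [hs.2]) hmem
        (le_self_add : ‖z - a‖ₑ ≤ D)
      have e : F₀ (p β + s • (z - a)) = ‖f (p β + s • (z - a))‖ₑ ^ 2 := by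
        rw [hF₀def, indicator_of_mem (hmem s hs.1 le_rfl)]
      have t : ‖f (p β)‖ₑ ≤ ‖f (p β + s • (z - a))‖ₑ + ‖f (p β + s • (z - a)) - f (p β)‖ₑ := by
        conv_lhs => rw [show f (p β) =
          f (p β + s • (z - a)) - (f (p β + s • (z - a)) - f (p β)) by ring]
        exact enorm_sub_le
      rw [e]
      refine ((pow_le_pow_left' t 2).trans (add_sq_le_two_mul _ _)).trans ?_
      gcongr
    have h2 := setLIntegral_mono' measurableSet_Ioc h1 (μ := volume)
    have hm₀ : Measurable fun s : ℝ => F₀ (p β + s • (z - a)) := hF₀.comp (by fun_prop)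
    have hm : Measurable fun s : ℝ => 2 * F₀ (p β + s • (z - a)) := hm₀.const_mul 2
    rw [lintegral_add_left hm, setLIntegral_const, setLIntegral_const, Real.volume_Ioc, sub_zero,
      lintegral_const_mul _ hm₀] at h2
    have h3 : ∫⁻ s in Ioc (0:ℝ) (1 / 2), F₀ (p β + s • (z - a)) ≤ A₀ β :=
      setLIntegral_le_lintegral _ _
    calc _ = 2 * (‖f (p β)‖ₑ ^ 2 * ENNReal.ofReal (1 / 2)) := hhalf _
      _ ≤ 2 * (2 * A₀ β + 2 * (D ^ 2 * A β) * ENNReal.ofReal (1 / 2)) := by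
          gcongr
          exact h2.trans (by gcongr)
      _ = 4 * A₀ β + 2 * (2 * (D ^ 2 * A β) * ENNReal.ofReal (1 / 2)) := by ring
      _ = _ := by rw [← hhalf]
  have hA₀I : ∫⁻ α in Icc (0:ℝ) (1 / 2), A₀ α ≤ J * X :=
    (lintegral_Icc_lintegral_affine_le hdet a hF₀ _).trans_eq (by rw [hFX])
  have hAI : ∫⁻ α in Icc (0:ℝ) (1 / 2), A α ≤ J * Y :=
    (lintegral_Icc_lintegral_affine_le hdet a hF _).trans_eq (by rw [hFY])
  have hleft : ∫⁻ β in Icc (0:ℝ) (1 / 2), ‖f (p β)‖ₑ ^ 2 ≤ 4 * (J * X) + 2 * (D ^ 2 * (J * Y)) := by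
    refine (setLIntegral_mono' measurableSet_Icc hinner).trans ?_
    rw [lintegral_add_right _ ((hAm.const_mul _).const_mul _), lintegral_const_mul' _ _ (by simp),
      lintegral_const_mul' _ _ (by simp), lintegral_const_mul _ hAm]
    gcongr
  set Q : ℝ → ℝ → ℝ≥0∞ := fun α β => ‖f (p β) - f (p α)‖ₑ ^ 2 with hQ
  have hosc : ∫⁻ α in Icc (0:ℝ) 1, ∫⁻ β in Icc (0:ℝ) 1, Q α β ≤ 8 * D ^ 2 * J * Y :=
    lintegral_lintegral_enorm_sub_sq_le hU htri hdet le_self_add le_add_self hf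
  -- Any point of the edge is compared with the points of the near half, and the comparison is
  -- averaged over that half.
  have hpt : ∀ α, ‖f (p α)‖ₑ ^ 2 ≤ 4 * (∫⁻ β in Icc (0:ℝ) 1, Q α β) +
      4 * (4 * (J * X) + 2 * (D ^ 2 * (J * Y))) := by
    intro α
    have h1 : ∀ β, ‖f (p α)‖ₑ ^ 2 ≤ 2 * Q α β + 2 * ‖f (p β)‖ₑ ^ 2 := by
      intro β
      have t : ‖f (p α)‖ₑ ≤ ‖f (p β) - f (p α)‖ₑ + ‖f (p β)‖ₑ := by
        conv_lhs => rw [show f (p α) = f (p β) - (f (p β) - f (p α)) by ring]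
        exact enorm_sub_le.trans_eq (add_comm _ _)
      exact (pow_le_pow_left' t 2).trans (add_sq_le_two_mul _ _)
    have h2 := lintegral_mono (μ := volume.restrict (Icc (0:ℝ) (1 / 2))) h1
    have hm : Measurable fun β : ℝ => 2 * ‖f (p β)‖ₑ ^ 2 :=
      ((hfm.comp hpm).enorm.pow_const 2).const_mul 2
    rw [setLIntegral_const, Real.volume_Icc, sub_zero, lintegral_add_right _ hm,
      lintegral_const_mul' _ _ (by simp), lintegral_const_mul' _ _ (by simp)] at h2
    have h3 : ∫⁻ β in Icc (0:ℝ) (1 / 2), Q α β ≤ ∫⁻ β in Icc (0:ℝ) 1, Q α β :=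
      lintegral_mono_set (Icc_subset_Icc le_rfl (by norm_num))
    calc _ = 2 * (‖f (p α)‖ₑ ^ 2 * ENNReal.ofReal (1 / 2)) := hhalf _
      _ ≤ 2 * (2 * (∫⁻ β in Icc (0:ℝ) 1, Q α β) + 2 * (4 * (J * X) + 2 * (D ^ 2 * (J * Y)))) := by
          gcongr
          exact h2.trans (by gcongr)
      _ = _ := by ring
  rw [lintegral_arcLength hab (F := fun x => ‖f x‖ₑ ^ 2) (hfm.enorm.pow_const 2), mul_assoc]
  gcongr
  calc _ ≤ ∫⁻ α in Icc (0:ℝ) 1, (4 * (∫⁻ β in Icc (0:ℝ) 1, Q α β) +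
          4 * (4 * (J * X) + 2 * (D ^ 2 * (J * Y)))) := lintegral_mono hpt
    _ = 4 * (∫⁻ α in Icc (0:ℝ) 1, ∫⁻ β in Icc (0:ℝ) 1, Q α β) +
          4 * (4 * (J * X) + 2 * (D ^ 2 * (J * Y))) := by
        rw [lintegral_add_right _ measurable_const, lintegral_const_mul' _ _ (by simp),
          setLIntegral_const]
        simp
    _ ≤ 4 * (8 * D ^ 2 * J * Y) + 4 * (4 * (J * X) + 2 * (D ^ 2 * (J * Y))) := by gcongr
    _ = 16 * (J * X) + 40 * (D ^ 2 * J * Y) := by ring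
    _ ≤ 48 * (J * X) + 48 * (D ^ 2 * J * Y) + (48 * (J * Y) + 48 * (D ^ 2 * J * X)) := by
        refine le_trans ?_ le_self_add
        gcongr <;> norm_num
    _ = _ := by ring

end MixedVEM

namespace MixedVEM

/-! ### Mollification -/

/-- In the plane the dilation has Jacobian `l ^ 2 ≥ 1 / 4`, which costs at most a factor `4` in the
squared norm. -/
theorem eLpNorm_comp_dilation_le {E : Type*} [NormedAddCommGroup E] {h : Plane → E} (hh : Continuous h) (z : Plane) {l : ℝ}
    (hl : 1 / 2 ≤ l) :
    eLpNorm (fun x => h (z + l • (x - z))) 2 volume ≤ 2 * eLpNorm h 2 volume := by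
  have hl0 : l ≠ 0 := by linarith
  have hsq : eLpNorm (fun x => h (z + l • (x - z))) 2 volume ^ 2 ≤
      (2 * eLpNorm h 2 volume) ^ 2 := by
    rw [mul_pow, eLpNorm_two_sq, eLpNorm_two_sq,
      lintegral_sub_right_eq_self (fun x => ‖h (z + l • x)‖ₑ ^ 2) z]
    have hm : Measurable fun x => ‖h (z + x)‖ₑ ^ 2 :=
      ((hh.comp (by fun_prop)).enorm.measurable).pow_const 2
    rw [← lintegral_map (f := fun x => ‖h (z + x)‖ₑ ^ 2) (g := fun x : Plane => l • x) hm
      (measurable_const_smul l), Measure.map_addHaar_smul _ hl0, lintegral_smul_measure,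
      lintegral_add_left_eq_self (fun x => ‖h x‖ₑ ^ 2) z, smul_eq_mul]
    gcongr
    rw [show (2 : ENNReal) ^ 2 = ENNReal.ofReal 4 by norm_num]
    apply ENNReal.ofReal_le_ofReal
    rw [finrank_euclideanSpace_fin, abs_of_nonneg (by positivity)]
    rw [inv_le_comm₀ (by positivity) (by norm_num)]
    nlinarith
  exact (ENNReal.pow_le_pow_left_iff two_ne_zero).1 hsq

section Mollify

variable {E : Type*} [NormedAddCommGroup E] [NormedSpace ℝ E]

/-- The convolution of `F` with a normalized bump function. -/
def mollify (φ : ContDiffBump (0 : Plane)) (F : Plane → E) (x : Plane) : E :=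
  ∫ t, φ.normed volume t • F (x - t)

theorem mollify_eq_convolution (φ : ContDiffBump (0 : Plane)) (F : Plane → E) :
    mollify φ F = convolution (φ.normed volume) F (ContinuousLinearMap.lsmul ℝ ℝ) volume := rfl

theorem integrable_mollify (φ : ContDiffBump (0 : Plane)) {F : Plane → E}
    (hF : LocallyIntegrable F volume) (x : Plane) :
    Integrable fun t => φ.normed volume t • F (x - t) :=
  φ.hasCompactSupport_normed.convolutionExists_left (ContinuousLinearMap.lsmul ℝ ℝ)
    φ.continuous_normed hF x

theorem mollify_sub (φ : ContDiffBump (0 : Plane)) {F H : Plane → E}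
    (hF : LocallyIntegrable F volume) (hH : LocallyIntegrable H volume) (x : Plane) :
    mollify φ (F - H) x = mollify φ F x - mollify φ H x := by
  simp only [mollify, Pi.sub_apply, smul_sub]
  exact integral_sub (integrable_mollify φ hF x) (integrable_mollify φ hH x)

theorem contDiff_mollify [CompleteSpace E] (φ : ContDiffBump (0 : Plane)) {F : Plane → E}
    (hF : LocallyIntegrable F volume) : ContDiff ℝ ∞ (mollify φ F) :=
  φ.hasCompactSupport_normed.contDiff_convolution_left (n := (⊤ : ℕ∞)) (ContinuousLinearMap.lsmul ℝ ℝ)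
    φ.contDiff_normed hF

/-- The normalized bump is a probability density: Cauchy–Schwarz for that measure, then Tonelli and
translation invariance. -/
theorem eLpNorm_mollify_le (φ : ContDiffBump (0 : Plane)) {F : Plane → E}
    (hF : AEStronglyMeasurable F volume) :
    eLpNorm (mollify φ F) 2 volume ≤ eLpNorm F 2 volume := by
  have hsq : eLpNorm (mollify φ F) 2 volume ^ 2 ≤ eLpNorm F 2 volume ^ 2 := by
    rw [eLpNorm_two_sq, eLpNorm_two_sq]
    set r : Plane → ENNReal := fun t => ‖φ.normed volume t‖ₑ with hr
    have hrm : Measurable r := φ.continuous_normed.measurable.enorm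
    have hr1 : ∫⁻ t, r t = 1 := by
      have := ofReal_integral_norm_eq_lintegral_enorm (φ.integrable_normed (μ := volume))
      rw [hr, ← this]
      simp only [Real.norm_eq_abs, abs_of_nonneg (φ.nonneg_normed _), φ.integral_normed,
        ENNReal.ofReal_one]
    set ν := (volume : Measure Plane).withDensity r with hν
    have hν1 : ν univ = 1 := by
      rw [hν, withDensity_apply _ MeasurableSet.univ, Measure.restrict_univ, hr1]
    have hFx : ∀ x, AEMeasurable (fun t => ‖F (x - t)‖ₑ) volume := fun x =>
      (hF.comp_quasiMeasurePreserving
        (quasiMeasurePreserving_sub_left_of_right_invariant volume x)).enorm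
    have hpt : ∀ x, ‖mollify φ F x‖ₑ ^ 2 ≤ ∫⁻ t, r t * ‖F (x - t)‖ₑ ^ 2 := by
      intro x
      have h1 : ‖mollify φ F x‖ₑ ≤ ∫⁻ t, ‖F (x - t)‖ₑ ∂ν := by
        rw [hν, lintegral_withDensity_eq_lintegral_mul₀ hrm.aemeasurable (hFx x)]
        refine (enorm_integral_le_lintegral_enorm _).trans_eq (lintegral_congr fun t => ?_)
        rw [enorm_smul]; rfl
      have hac : ν ≪ volume := withDensity_absolutelyContinuous _ _
      refine (pow_le_pow_left' h1 2).trans ((lintegral_sq_le ν ((hFx x).mono_ac hac)).trans_eq ?_)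
      rw [hν1, one_mul, hν, lintegral_withDensity_eq_lintegral_mul₀ hrm.aemeasurable
        ((hFx x).pow_const 2)]
      rfl
    have hunc : AEMeasurable (Function.uncurry fun (x t : Plane) => r t * ‖F (x - t)‖ₑ ^ 2)
        (volume.prod volume) := by
      have h1 : AEStronglyMeasurable (fun p : Plane × Plane => F (p.1 - p.2))
          (volume.prod volume) := hF.comp_quasiMeasurePreserving
        (quasiMeasurePreserving_sub_of_right_invariant volume volume)
      exact ((hrm.comp measurable_snd).aemeasurable).mul (h1.enorm.pow_const 2)
    calc _ ≤ ∫⁻ x, ∫⁻ t, r t * ‖F (x - t)‖ₑ ^ 2 := lintegral_mono hpt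
      _ = ∫⁻ t, ∫⁻ x, r t * ‖F (x - t)‖ₑ ^ 2 := lintegral_lintegral_swap hunc
      _ = ∫⁻ t, r t * ∫⁻ x, ‖F x‖ₑ ^ 2 := by
          refine lintegral_congr fun t => ?_
          rw [lintegral_const_mul' _ _ enorm_ne_top,
            lintegral_sub_right_eq_self (fun x => ‖F x‖ₑ ^ 2) t]
      _ = _ := by rw [lintegral_mul_const _ hrm, hr1, one_mul]
  exact (ENNReal.pow_le_pow_left_iff two_ne_zero).1 hsq

/-- Approximate `F` by a continuous, compactly supported `g` up to `ε / 4`. Dilation and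
mollification at most double the norm of `F - g`, which costs `ε / 2`, and returning from `g` to `F`
costs `ε / 4`. For `g` itself uniform continuity leaves `ε / 4`, since points of the bounded set `U`
move by at most `|l n - 1| * R`. -/
theorem tendsto_eLpNorm_mollify_dilation_sub [CompleteSpace E] {F : Plane → E}
    (hF : MemLp F 2 volume)
    {U : Set Plane} (hU : MeasurableSet U) (hb : Bornology.IsBounded U) (z : Plane)
    {l : ℕ → ℝ} (hl : Tendsto l atTop (𝓝 1)) {φ : ℕ → ContDiffBump (0 : Plane)}
    (hφ : Tendsto (fun n => (φ n).rOut) atTop (𝓝 0)) :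
    Tendsto (fun n => eLpNorm (fun x => mollify (φ n) F (z + l n • (x - z)) - F x) 2
      (volume.restrict U)) atTop (𝓝 0) := by
  rw [ENNReal.tendsto_nhds_zero]
  intro ε hε
  have hε4 : ε / 4 ≠ 0 := (ENNReal.div_pos hε.ne' (by simp)).ne'
  obtain ⟨g, hgs, hFg, hgc, hgL⟩ := hF.exists_hasCompactSupport_eLpNorm_sub_le (by simp) hε4
  have hFl : LocallyIntegrable F volume := hF.locallyIntegrable (by norm_num)
  have hgl : LocallyIntegrable g volume := hgL.locallyIntegrable (by norm_num)
  have hvol : volume U ^ (2 : ENNReal).toReal⁻¹ ≠ ⊤ :=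
    ENNReal.rpow_ne_top_of_nonneg (by positivity) hb.measure_lt_top.ne
  obtain ⟨η, hη, hηε⟩ := ENNReal.exists_nnreal_pos_mul_lt hvol hε4
  have huc := hgs.uniformContinuous_of_continuous hgc
  obtain ⟨θ, hθ, hgθ⟩ := Metric.uniformContinuous_iff.1 huc η hη
  obtain ⟨R, hR⟩ := hb.subset_closedBall z
  have hlim : Tendsto (fun n => (φ n).rOut + |l n - 1| * R) atTop (𝓝 0) := by
    have h1 : Tendsto (fun n => |l n - 1|) atTop (𝓝 0) := by
      simpa using (hl.sub_const 1).abs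
    simpa using hφ.add (h1.mul_const R)
  filter_upwards [hlim.eventually_lt_const hθ, hl.eventually_const_le (by norm_num : (1/2 : ℝ) < 1)]
    with n hn hln
  set A : Plane → Plane := fun x => z + l n • (x - z) with hA
  have hAc : Continuous A := by fun_prop
  have hmc : ∀ {H : Plane → E}, LocallyIntegrable H volume → Continuous (mollify (φ n) H) :=
    fun hH => (contDiff_mollify (φ n) hH).continuous
  have e : (fun x => mollify (φ n) F (A x) - F x) =
      (fun x => mollify (φ n) (F - g) (A x)) + ((fun x => mollify (φ n) g (A x) - g x) +
        fun x => -((F - g) x)) := by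
    ext x
    simp only [Pi.add_apply, mollify_sub (φ n) hFl hgl, Pi.sub_apply]
    abel
  have hm1 : AEStronglyMeasurable (fun x => mollify (φ n) (F - g) (A x)) (volume.restrict U) :=
    ((hmc (hFl.sub hgl)).comp hAc).aestronglyMeasurable
  have hm2 : AEStronglyMeasurable (fun x => mollify (φ n) g (A x) - g x) (volume.restrict U) :=
    (((hmc hgl).comp hAc).sub hgc).aestronglyMeasurable
  have hm3 : AEStronglyMeasurable (fun x => -((F - g) x)) (volume.restrict U) :=
    (hF.1.sub hgc.aestronglyMeasurable).neg.restrict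
  have b1 : eLpNorm (fun x => mollify (φ n) (F - g) (A x)) 2 (volume.restrict U) ≤
      2 * (ε / 4) :=
    (eLpNorm_mono_measure _ Measure.restrict_le_self).trans
      ((eLpNorm_comp_dilation_le (hmc (hFl.sub hgl)) z hln).trans
        (mul_le_mul_right ((eLpNorm_mollify_le (φ n)
          (hF.1.sub hgc.aestronglyMeasurable)).trans hFg) 2))
  have b3 : eLpNorm (fun x => -((F - g) x)) 2 (volume.restrict U) ≤ ε / 4 := by
    have : eLpNorm (fun x => -((F - g) x)) 2 (volume.restrict U) =
      eLpNorm (F - g) 2 (volume.restrict U) := eLpNorm_neg _ _ _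
    rw [this]
    exact (eLpNorm_mono_measure _ Measure.restrict_le_self).trans hFg
  have b2 : eLpNorm (fun x => mollify (φ n) g (A x) - g x) 2 (volume.restrict U) ≤ ε / 4 := by
    refine (eLpNorm_le_of_ae_bound (C := η) ?_).trans ?_
    · refine (ae_restrict_iff' hU).2 (Eventually.of_forall fun x hx => ?_)
      rw [← dist_eq_norm, mollify_eq_convolution]
      refine dist_convolution_le (R := (φ n).rOut) η.2
        (φ n).support_normed_eq.subset (φ n).nonneg_normed (φ n).integral_normed
        hgc.aestronglyMeasurable fun y hy => (hgθ ?_).le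
      refine lt_of_le_of_lt ?_ hn
      refine (dist_triangle y (A x) x).trans (add_le_add hy.le ?_)
      have : A x - x = (l n - 1) • (x - z) := by simp only [hA]; module
      rw [dist_eq_norm, this, norm_smul, Real.norm_eq_abs, ← dist_eq_norm]
      exact mul_le_mul_of_nonneg_left (hR hx) (abs_nonneg _)
    · rw [Measure.restrict_apply_univ, mul_comm, ENNReal.ofReal_coe_nnreal]
      exact hηε.le
  rw [e]
  refine (eLpNorm_add_le hm1 (hm2.add hm3) (by norm_num)).trans ?_
  refine (add_le_add b1 ((eLpNorm_add_le hm2 hm3 (by norm_num)).trans (add_le_add b2 b3))).trans_eq ?_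
  rw [← two_mul (ε / 4), ← add_mul]
  norm_num
  exact ENNReal.mul_div_cancel (by simp) (by simp)

end Mollify

/-- The derivative falls on the bump; the bump reflected and centred at `y` is a test function in
`U`, so the definition of the weak gradient moves the derivative to `u`. -/
theorem gradient_mollify_indicator {U : Set Plane} (hU : IsOpen U) {u : Plane → ℝ}
    {G : Plane → Plane} (hu : IsH1 U u G) (φ : ContDiffBump (0 : Plane)) {y : Plane}
    (hy : Metric.closedBall y φ.rOut ⊆ U) :
    gradient (mollify φ (U.indicator u)) y = mollify φ (U.indicator G) y := by
  have hUm := hU.measurableSet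
  have hf : LocallyIntegrable (U.indicator u) volume :=
    ((memLp_indicator_iff_restrict hUm).2 hu.memLp).locallyIntegrable (by norm_num)
  have hG : LocallyIntegrable (U.indicator G) volume :=
    ((memLp_indicator_iff_restrict hUm).2 hu.memLp_grad).locallyIntegrable (by norm_num)
  set ρ := φ.normed (volume : Measure Plane) with hρ
  have hρs : ContDiff ℝ ∞ ρ := φ.contDiff_normed
  have hρc : HasCompactSupport ρ := φ.hasCompactSupport_normed
  set ψ : Plane → ℝ := fun x => ρ (y - x) with hψ
  have hψ' : ∀ x v, fderiv ℝ ψ x v = - fderiv ℝ ρ (y - x) v := by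
    intro x v
    have h1 : HasFDerivAt (fun x : Plane => y - x) (-(ContinuousLinearMap.id ℝ Plane)) x :=
      (hasFDerivAt_id x).const_sub y
    have h2 := ((hρs.differentiable (by simp)) (y - x)).hasFDerivAt.comp x h1
    have h3 : fderiv ℝ ψ x = _ := h2.fderiv
    rw [h3]
    simp
  have htest : IsTest U ψ := by
    have hsupp : tsupport ψ ⊆ Metric.closedBall y φ.rOut := by
      refine closure_minimal (fun x hx => ?_) Metric.isClosed_closedBall
      have : y - x ∈ Function.support ρ := hx
      rw [hρ, φ.support_normed_eq] at this
      rw [Metric.mem_closedBall, dist_comm, dist_eq_norm]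
      simpa using (mem_ball_zero_iff.1 this).le
    exact ⟨hρs.comp (contDiff_const.sub contDiff_id),
      HasCompactSupport.of_support_subset_isCompact (isCompact_closedBall y φ.rOut)
        (subset_closure.trans hsupp), hsupp.trans hy⟩
  refine ext_inner_right ℝ fun v => ?_
  have hD := hρc.hasFDerivAt_convolution_left (ContinuousLinearMap.lsmul ℝ ℝ)
    (hρs.of_le (by simp)) hf y
  have e1 : ⟪gradient (mollify φ (U.indicator u)) y, v⟫ =
      fderiv ℝ (mollify φ (U.indicator u)) y v := by simp [gradient]
  rw [e1, mollify_eq_convolution, hD.fderiv]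
  have hint := (hρc.fderiv ℝ).convolutionExists_left
    ((ContinuousLinearMap.lsmul ℝ ℝ).precompL Plane : _ →L[ℝ] ℝ →L[ℝ] Plane →L[ℝ] ℝ)
    (hρs.continuous_fderiv (by simp)) hf y
  rw [convolution_def, ContinuousLinearMap.integral_apply hint]
  have e2 : ∫ t, ((ContinuousLinearMap.lsmul ℝ ℝ).precompL Plane (fderiv ℝ ρ t)
      (U.indicator u (y - t)) : Plane →L[ℝ] ℝ) v =
      ∫ x, fderiv ℝ ρ (y - x) v * U.indicator u x := by
    rw [← integral_sub_left_eq_self (fun x => fderiv ℝ ρ (y - x) v * U.indicator u x) volume y]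
    simp [ContinuousLinearMap.precompL_apply]
  rw [e2]
  have e3 : ∀ x, fderiv ℝ ρ (y - x) v * U.indicator u x =
      U.indicator (fun x => -(u x * fderiv ℝ ψ x v)) x := by
    intro x
    by_cases hx : x ∈ U
    · rw [indicator_of_mem hx, indicator_of_mem hx, hψ']; ring
    · rw [indicator_of_notMem hx, indicator_of_notMem hx, mul_zero]
  simp_rw [e3]
  rw [integral_indicator hUm, integral_neg, hu.weak ψ htest v, neg_neg]
  have hmol : mollify φ (U.indicator G) y = ∫ x, ψ x • U.indicator G x := by
    rw [← integral_sub_left_eq_self (fun x => ψ x • U.indicator G x) volume y]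
    simp [mollify, hψ, hρ]
  have hint2 : Integrable fun x => ψ x • U.indicator G x := by
    have := (integrable_mollify φ hG y).comp_sub_left y
    simpa using this
  rw [hmol, real_inner_comm, ← integral_inner hint2, ← integral_indicator hUm]
  refine integral_congr_ae (Eventually.of_forall fun x => ?_)
  by_cases hx : x ∈ U
  · simp only [indicator_of_mem hx, real_inner_smul_right, real_inner_comm v, mul_comm]
  · simp [indicator_of_notMem hx]

/-- On a domain that is star-shaped with respect to a ball, the smooth functions are dense
in `H¹`. -/
theorem exists_contDiff_tendsto_of_isH1 {U : Set Plane} (hU : IsOpen U)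
    (hb : Bornology.IsBounded U) {z : Plane} {ρ : ℝ} (hρ : 0 < ρ)
    (hstar : ∀ y ∈ Metric.ball z ρ, StarConvex ℝ y U) {u : Plane → ℝ} {G : Plane → Plane}
    (hu : IsH1 U u G) :
    ∃ w : ℕ → Plane → ℝ, (∀ n, ContDiff ℝ ∞ (w n)) ∧
      Tendsto (fun n => eLpNorm (fun x => w n x - u x) 2 (volume.restrict U)) atTop (𝓝 0) ∧
      Tendsto (fun n => eLpNorm (fun x => gradient (w n) x - G x) 2 (volume.restrict U))
        atTop (𝓝 0) := by
  have hUm := hU.measurableSet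
  have hfL : MemLp (U.indicator u) 2 volume := (memLp_indicator_iff_restrict hUm).2 hu.memLp
  have hGL : MemLp (U.indicator G) 2 volume := (memLp_indicator_iff_restrict hUm).2 hu.memLp_grad
  have hfl : LocallyIntegrable (U.indicator u) volume := hfL.locallyIntegrable (by norm_num)
  have hGl : LocallyIntegrable (U.indicator G) volume := hGL.locallyIntegrable (by norm_num)
  set d : ℕ → ℝ := fun n => 1 / ((n : ℝ) + 1) with hd
  have hd0 : ∀ n, 0 < d n := fun n => by positivity
  have hd1 : ∀ n, d n ≤ 1 := fun n => by
    rw [hd]; simp only; rw [div_le_one (by positivity)]; linarith [Nat.cast_nonneg (α := ℝ) n]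
  have hdlim : Tendsto d atTop (𝓝 0) := tendsto_one_div_add_atTop_nhds_zero_nat
  set l : ℕ → ℝ := fun n => 1 - d n with hldef
  have hl : Tendsto l atTop (𝓝 1) := by simpa using hdlim.const_sub 1
  set φ : ℕ → ContDiffBump (0 : Plane) := fun n =>
    ⟨d n * ρ / 4, d n * ρ / 2, by have := hd0 n; positivity, by nlinarith [mul_pos (hd0 n) hρ]⟩
    with hφdef
  have hφ : Tendsto (fun n => (φ n).rOut) atTop (𝓝 0) := by
    simpa using (hdlim.mul_const ρ).div_const 2
  set A : ℕ → Plane → Plane := fun n x => z + l n • (x - z) with hA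
  -- Shrinking by `1 - d n` towards `z` leaves room `d n * ρ` around each image point, as `(1 - d n)
  -- • x + d n • y'` is in `U` for every `y'` in the ball. The mollification radius is half of that,
  -- so the extension of `u` by zero is never seen.
  have hball : ∀ n, ∀ x ∈ U, Metric.closedBall (A n x) (φ n).rOut ⊆ U := by
    intro n x hx y hy
    have hdn := hd0 n
    have h1 : z + (d n)⁻¹ • (y - A n x) ∈ Metric.ball z ρ := by
      rw [mem_ball_iff_norm, add_sub_cancel_left, norm_smul, norm_inv, Real.norm_eq_abs,
        abs_of_pos hdn, ← dist_eq_norm, inv_mul_lt_iff₀ hdn]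
      have : dist y (A n x) ≤ d n * ρ / 2 := hy
      nlinarith [mul_pos hdn hρ]
    have h2 := combo_mem_of_starConvex_ball hstar (subset_closure hx) h1 hdn (hd1 n)
    convert h2 using 1
    rw [smul_add, smul_smul, mul_inv_cancel₀ hdn.ne', one_smul]
    simp only [hA, hldef]
    module
  refine ⟨fun n x => mollify (φ n) (U.indicator u) (A n x), fun n => ?_, ?_, ?_⟩
  · exact (contDiff_mollify (φ n) hfl).comp
      (contDiff_const.add ((contDiff_id.sub contDiff_const).const_smul (l n)))
  · refine (tendsto_eLpNorm_mollify_dilation_sub hfL hUm hb z hl hφ).congr fun n => ?_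
    refine eLpNorm_congr_ae ((ae_restrict_iff' hUm).2 (Eventually.of_forall fun x hx => ?_))
    simp only [indicator_of_mem hx, hA]
  · have hgrad : ∀ n, ∀ x ∈ U,
        gradient (fun x => mollify (φ n) (U.indicator u) (A n x)) x =
          l n • mollify (φ n) (U.indicator G) (A n x) := by
      intro n x hx
      rw [← gradient_mollify_indicator hU hu (φ n) (hball n x hx)]
      have h1 : HasFDerivAt (A n) (l n • ContinuousLinearMap.id ℝ Plane) x :=
        (((hasFDerivAt_id x).sub_const z).const_smul (l n)).const_add z
      have h2 := (((contDiff_mollify (φ n) hfl).differentiable (by simp)) (A n x)).hasFDerivAt.comp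
        x h1
      have h3 : fderiv ℝ (fun x => mollify (φ n) (U.indicator u) (A n x)) x = _ := h2.fderiv
      rw [gradient, gradient, h3, ← map_smul]
      congr 1
      ext v
      simp
    have hT := tendsto_eLpNorm_mollify_dilation_sub hGL hUm hb z hl hφ
    have hle : ∀ n, eLpNorm (fun x =>
        gradient (fun x => mollify (φ n) (U.indicator u) (A n x)) x - G x) 2 (volume.restrict U) ≤
        eLpNorm (fun x => mollify (φ n) (U.indicator G) (z + l n • (x - z)) - U.indicator G x) 2
          (volume.restrict U) + ENNReal.ofReal (d n) * eLpNorm G 2 (volume.restrict U) := by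
      intro n
      have hm1 : AEStronglyMeasurable (fun x => mollify (φ n) (U.indicator G) (z + l n • (x - z)) -
          U.indicator G x) (volume.restrict U) := by
        refine AEStronglyMeasurable.sub ?_ hGL.1.restrict
        have hc : Continuous fun x : Plane => z + l n • (x - z) := by fun_prop
        exact ((contDiff_mollify (φ n) hGl).continuous.comp hc).aestronglyMeasurable
      -- The chain rule contributes a factor `l n = 1 - d n`; the defect `-d n • G` vanishes in the
      -- limit.
      have e : (fun x => gradient (fun x => mollify (φ n) (U.indicator u) (A n x)) x - G x)
          =ᵐ[volume.restrict U]
          l n • (fun x => mollify (φ n) (U.indicator G) (z + l n • (x - z)) - U.indicator G x) +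
            (-d n) • G := by
        refine (ae_restrict_iff' hUm).2 (Eventually.of_forall fun x hx => ?_)
        beta_reduce
        rw [hgrad n x hx]
        simp only [Pi.add_apply, Pi.smul_apply, indicator_of_mem hx, hldef, hA]
        module
      rw [eLpNorm_congr_ae e]
      refine (eLpNorm_add_le (hm1.const_smul _) (hu.memLp_grad.1.const_smul _)
        (by norm_num)).trans ?_
      rw [eLpNorm_const_smul, eLpNorm_const_smul, enorm_neg,
        Real.enorm_of_nonneg (hd0 n).le]
      gcongr
      have hln : 0 ≤ l n := by simp only [hldef]; linarith [hd1 n]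
      refine mul_le_of_le_one_left' ?_
      rw [Real.enorm_of_nonneg hln]
      apply ENNReal.ofReal_le_one.2
      simp only [hldef]; linarith [hd0 n]
    have hlim2 : Tendsto (fun n => ENNReal.ofReal (d n) * eLpNorm G 2 (volume.restrict U)) atTop
        (𝓝 0) := by
      have h1 : Tendsto (fun n => ENNReal.ofReal (d n)) atTop (𝓝 0) := by
        simpa using ENNReal.tendsto_ofReal hdlim
      simpa using ENNReal.Tendsto.mul_const h1 (Or.inr hu.memLp_grad.2.ne)
    refine tendsto_of_tendsto_of_tendsto_of_le_of_le tendsto_const_nhds ?_ (fun _ => zero_le) hle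
    simpa using hT.add hlim2

end MixedVEM

namespace MixedVEM

/-! ### Edges of regular elements -/

namespace Element

variable (K : Element) (i : Fin (K.m + 3))

theorem vertex_ne_vertex_add_one : K.vertex i ≠ K.vertex (i + 1) := by
  intro h
  have h1 := K.injective h
  simp at h1

theorem edgeLength_pos : 0 < K.edgeLength i := dist_pos.2 (K.vertex_ne_vertex_add_one i)

theorem segment_subset_frontier :
    segment ℝ (K.vertex i) (K.vertex (i + 1)) ⊆ frontier K.carrier := by
  rw [K.frontier_eq]
  exact subset_iUnion (fun i => segment ℝ (K.vertex i) (K.vertex (i + 1))) i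

theorem dist_le_diam {x y : Plane} (hx : x ∈ closure K.carrier) (hy : y ∈ closure K.carrier) :
    dist x y ≤ Metric.diam K.carrier := by
  rw [← Metric.diam_closure]
  exact Metric.dist_le_diam_of_mem K.isBounded.closure hx hy

theorem vertex_mem_closure : K.vertex i ∈ closure K.carrier :=
  frontier_subset_closure (K.segment_subset_frontier i (left_mem_segment ℝ _ _))

theorem diam_pos : 0 < Metric.diam K.carrier :=
  (K.edgeLength_pos 0).trans_le
    (K.dist_le_diam (K.vertex_mem_closure 0) (K.vertex_mem_closure (0 + 1)))

instance : IsFiniteMeasure (K.edgeMeasure i) := by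
  refine ⟨?_⟩
  have := lintegral_arcLength (K.vertex_ne_vertex_add_one i) (F := fun _ => 1) measurable_const
  rw [lintegral_one] at this
  rw [edgeMeasure, this]
  simp

instance : IsFiniteMeasure ((volume : Measure Plane).restrict K.carrier) :=
  ⟨by rw [Measure.restrict_apply_univ]; exact K.isBounded.measure_lt_top⟩

theorem memLp_edgeMeasure_of_continuous {f : Plane → ℝ} (hf : Continuous f) :
    MemLp f 2 (K.edgeMeasure i) := by
  have hc : IsCompact (segment ℝ (K.vertex i) (K.vertex (i + 1))) := by
    rw [segment_eq_image']
    exact isCompact_Icc.image (by fun_prop)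
  obtain ⟨M, hM⟩ := hc.exists_bound_of_continuousOn hf.continuousOn
  refine MemLp.of_bound hf.aestronglyMeasurable M ?_
  exact (ae_restrict_iff' hc.measurableSet).2 (Eventually.of_forall hM)

theorem abs_normal_le_one (j : Fin 2) : |K.normal i j| ≤ 1 := by
  have h := K.edgeLength_pos i
  have hle : ∀ j, |K.vertex i j - K.vertex (i + 1) j| ≤ K.edgeLength i := fun j => by
    rw [edgeLength, dist_eq_norm]
    exact PiLp.norm_apply_le (K.vertex i - K.vertex (i + 1)) j
  have h0 := hle 0
  have h1 := hle 1
  rw [abs_sub_comm] at h1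
  fin_cases j <;>
  · simp only [normal, PiLp.smul_apply, smul_eq_mul, abs_mul, abs_inv, abs_of_pos h]
    rw [inv_mul_le_iff₀ h, mul_one]
    simpa

variable {K}

/-- The cone over an edge with apex at the centre of the ball of a regular element. -/
theorem affine_mem_of_starConvex_ball {z : Plane} {ρ : ℝ} (hρ : 0 < ρ)
    (hstar : ∀ y ∈ Metric.ball z ρ, StarConvex ℝ y K.carrier) (α s : ℝ) (hα : 0 ≤ α) (hs : 0 < s)
    (hαs : α + s ≤ 1) :
    K.vertex i + α • (K.vertex (i + 1) - K.vertex i) + s • (z - K.vertex i) ∈ K.carrier := by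
  have hx : K.vertex i + (α / (1 - s)) • (K.vertex (i + 1) - K.vertex i) ∈
      segment ℝ (K.vertex i) (K.vertex (i + 1)) := by
    rw [segment_eq_image']
    exact ⟨_, ⟨div_nonneg hα (by linarith), div_le_one_of_le₀ (by linarith) (by linarith)⟩, rfl⟩
  have h := combo_mem_of_starConvex_ball hstar
    (frontier_subset_closure (K.segment_subset_frontier i hx)) (Metric.mem_ball_self hρ) hs
    (by linarith)
  convert h using 1
  have : (1 - s) * (α / (1 - s)) = α := by
    rcases eq_or_ne (1 - s) 0 with h0 | h0
    · rw [h0, zero_mul]; linarith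
    · field_simp
  rw [smul_add, smul_smul, this]
  module

/-- Both parts of shape regularity enter. With `h` the edge length and `d` the diameter, the ball
bounds the Jacobian below by `h * (C * d)`, so the squared constant is at most `h * 8 * d ^ 2 / (h *
C * d) = 8 * d / C`. The edge condition `d ≤ h / C` turns this into `8 * h / C ^ 2 ≤ (3 / C) ^ 2 *
h`. -/
theorem exists_eLpNorm_edgeMeasure_sub_le {C : ℝ} (hC : 0 < C) (hK : K.IsRegular C)
    {f : Plane → ℝ} (hf : ContDiff ℝ ∞ f) :
    ∃ c : ℝ, eLpNorm (fun x => f x - c) 2 (K.edgeMeasure i) ≤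
      ENNReal.ofReal (3 / C * Real.sqrt (K.edgeLength i)) *
        eLpNorm (gradient f) 2 (volume.restrict K.carrier) := by
  obtain ⟨hedge, z, hz, hstar⟩ := hK
  set a := K.vertex i with ha
  set b := K.vertex (i + 1) with hb
  set d := Metric.diam K.carrier with hd
  have hd0 : 0 < d := K.diam_pos
  have hl := K.edgeLength_pos i
  have hρ : 0 < C * d := by positivity
  have hJ : K.edgeLength i * (C * d) ≤ |det₂ (b - a) (z - a)| :=
    abs_det₂_ge_of_starConvex_ball K.isOpen hstar (K.vertex_ne_vertex_add_one i)
      (K.segment_subset_frontier i)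
  have hJ0 : 0 < |det₂ (b - a) (z - a)| := lt_of_lt_of_le (by positivity) hJ
  have hdist : ∀ j, ‖z - K.vertex j‖ₑ ≤ ENNReal.ofReal d := fun j => by
    rw [← ofReal_norm, ← dist_eq_norm]
    exact ENNReal.ofReal_le_ofReal (K.dist_le_diam (subset_closure hz) (K.vertex_mem_closure j))
  obtain ⟨c, hc⟩ := exists_lintegral_arcLength_enorm_sub_sq_le K.isOpen.measurableSet
    (K.vertex_ne_vertex_add_one i) (affine_mem_of_starConvex_ball i hρ hstar)
    (abs_pos.1 hJ0) (hdist i) (hdist (i + 1)) hf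
  refine ⟨c, (ENNReal.pow_le_pow_left_iff two_ne_zero).1 ?_⟩
  rw [mul_pow, eLpNorm_two_sq, eLpNorm_two_sq]
  refine hc.trans ?_
  rw [← mul_assoc]
  refine mul_le_mul_left ?_ _
  rw [← ENNReal.ofReal_pow hd0.le, ← ENNReal.ofReal_ofNat (n := 8), ← ENNReal.ofReal_mul (by norm_num),
    ← ENNReal.ofReal_mul (by positivity), ← ENNReal.ofReal_mul dist_nonneg,
    ← ENNReal.ofReal_pow (by positivity)]
  apply ENNReal.ofReal_le_ofReal
  rw [mul_pow, Real.sq_sqrt hl.le, abs_inv]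
  have h1 : dist (K.vertex i) (K.vertex (i + 1)) * (8 * d ^ 2 * |det₂ (b - a) (z - a)|⁻¹) ≤
      K.edgeLength i * (8 * d ^ 2 * (K.edgeLength i * (C * d))⁻¹) := by
    rw [edgeLength]
    gcongr
    exact hJ
  refine h1.trans ?_
  have h2 : K.edgeLength i * (8 * d ^ 2 * (K.edgeLength i * (C * d))⁻¹) = 8 * d / C := by
    field_simp
  have h3 : (3 / C) ^ 2 * K.edgeLength i = 9 * (K.edgeLength i / C) / C := by
    field_simp
    norm_num
  rw [h2, h3]
  have h4 : d ≤ K.edgeLength i / C := by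
    rw [le_div_iff₀ hC, mul_comm]
    exact (hedge i).le
  gcongr
  linarith

theorem exists_eLpNorm_edgeMeasure_le {C : ℝ} (hC : 0 < C) (hK : K.IsRegular C) :
    ∃ M : ENNReal, M ≠ ⊤ ∧ ∀ f : Plane → ℝ, ContDiff ℝ ∞ f →
      eLpNorm f 2 (K.edgeMeasure i) ≤ M * (eLpNorm f 2 (volume.restrict K.carrier) +
        eLpNorm (gradient f) 2 (volume.restrict K.carrier)) := by
  obtain ⟨hedge, z, hz, hstar⟩ := hK
  have hρ : 0 < C * Metric.diam K.carrier := mul_pos hC K.diam_pos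
  have hJ := abs_det₂_ge_of_starConvex_ball K.isOpen hstar (K.vertex_ne_vertex_add_one i)
      (K.segment_subset_frontier i)
  obtain ⟨M, hM, h⟩ := lintegral_arcLength_enorm_sq_le K.isOpen.measurableSet
    (K.vertex_ne_vertex_add_one i) (affine_mem_of_starConvex_ball i hρ hstar)
    (abs_pos.1 (lt_of_lt_of_le (mul_pos (K.edgeLength_pos i) hρ) hJ))
  -- Since `M ≤ (M + 1) ^ 2`, this choice avoids a square root.
  refine ⟨M + 1, by simpa using hM, fun f hf => (ENNReal.pow_le_pow_left_iff two_ne_zero).1 ?_⟩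
  have h1 := h f hf
  rw [← eLpNorm_two_sq, ← eLpNorm_two_sq, ← eLpNorm_two_sq] at h1
  refine h1.trans ?_
  rw [mul_pow]
  refine mul_le_mul' ?_ ?_
  · calc M ≤ M + (M + 1 + M * M) := le_self_add
      _ = (M + 1) ^ 2 := by ring
  · rw [add_sq]
    gcongr
    exact le_self_add

end Element

/-! ### Traces -/

theorem IsH1.mono {U V : Set Plane} {u : Plane → ℝ} {G : Plane → Plane} (h : IsH1 V u G)
    (hV : MeasurableSet V) (hUV : U ⊆ V) : IsH1 U u G where
  memLp := h.memLp.mono_measure (Measure.restrict_mono hUV le_rfl)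
  memLp_grad := h.memLp_grad.mono_measure (Measure.restrict_mono hUV le_rfl)
  weak φ hφ v := by
    have hz : ∀ x, x ∉ U → x ∉ tsupport φ := fun x hx hx' => hx (hφ.supp hx')
    rw [← setIntegral_eq_of_subset_of_forall_sdiff_eq_zero hV hUV,
      ← setIntegral_eq_of_subset_of_forall_sdiff_eq_zero hV hUV]
    · exact h.weak φ ⟨hφ.smooth, hφ.compact, hφ.supp.trans hUV⟩ v
    · intro x hx
      rw [image_eq_zero_of_notMem_tsupport (hz x hx.2), mul_zero]
    · intro x hx
      have : fderiv ℝ φ x = 0 := image_eq_zero_of_notMem_tsupport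
        fun h' => hz x hx.2 (tsupport_fderiv_subset ℝ h')
      simp [this]

theorem ae_eq_of_integral_isTest_eq {E : Type*} [NormedAddCommGroup E] [NormedSpace ℝ E]
    [CompleteSpace E] {U : Set Plane} (hU : IsOpen U) {f g : Plane → E}
    (hf : MemLp f 2 (volume.restrict U)) (hg : MemLp g 2 (volume.restrict U))
    (h : ∀ φ, IsTest U φ → ∫ x in U, φ x • f x = ∫ x in U, φ x • g x) :
    f =ᵐ[volume.restrict U] g := by
  have hfl : LocallyIntegrable f (volume.restrict U) := hf.locallyIntegrable (by norm_num)
  have hgl : LocallyIntegrable g (volume.restrict U) := hg.locallyIntegrable (by norm_num)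
  have key := hU.ae_eq_zero_of_integral_contDiff_smul_eq_zero
    (locallyIntegrableOn_of_locallyIntegrable_restrict (hfl.sub hgl)) fun φ hφ hc hs => ?_
  · refine (ae_restrict_iff' hU.measurableSet).2 (key.mono fun x hx hxU => ?_)
    exact sub_eq_zero.1 (hx hxU)
  · have e : ∫ x, φ x • (f - g) x = ∫ x in U, φ x • (f - g) x :=
      (setIntegral_eq_integral_of_forall_compl_eq_zero fun x hx => by
        rw [image_eq_zero_of_notMem_tsupport fun h' => hx (hs h'), zero_smul]).symm
    rw [e]
    simp only [Pi.sub_apply, smul_sub]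
    rw [integral_sub (hfl.integrable_smul_left_of_hasCompactSupport hφ.continuous hc)
      (hgl.integrable_smul_left_of_hasCompactSupport hφ.continuous hc), h φ ⟨hφ, hc, hs⟩, sub_self]

theorem integrable_smul_of_isTest {E : Type*} [NormedAddCommGroup E] [NormedSpace ℝ E]
    {U : Set Plane} {f : Plane → E} (hf : MemLp f 2 (volume.restrict U)) {φ : Plane → ℝ}
    (hφ : IsTest U φ) : Integrable (fun x => φ x • f x) (volume.restrict U) :=
  (hf.locallyIntegrable (by norm_num)).integrable_smul_left_of_hasCompactSupport
    hφ.smooth.continuous hφ.compact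

theorem IsH1.grad_ae_eq {U : Set Plane} (hU : IsOpen U) {u : Plane → ℝ} {G H : Plane → Plane}
    (hG : IsH1 U u G) (hH : IsH1 U u H) : G =ᵐ[volume.restrict U] H := by
  refine ae_eq_of_integral_isTest_eq hU hG.memLp_grad hH.memLp_grad fun φ hφ => ?_
  refine ext_inner_left ℝ fun v => ?_
  rw [← integral_inner (integrable_smul_of_isTest hG.memLp_grad hφ),
    ← integral_inner (integrable_smul_of_isTest hH.memLp_grad hφ)]
  have h := neg_injective ((hG.weak φ hφ v).symm.trans (hH.weak φ hφ v))
  simpa only [real_inner_smul_right, real_inner_comm v, mul_comm] using h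

theorem HasWeakDiv.ae_eq {U : Set Plane} (hU : IsOpen U) {σ : Plane → Plane} {d e : Plane → ℝ}
    (hd : HasWeakDiv U σ d) (he : HasWeakDiv U σ e) (hdL : MemLp d 2 (volume.restrict U))
    (heL : MemLp e 2 (volume.restrict U)) : d =ᵐ[volume.restrict U] e := by
  refine ae_eq_of_integral_isTest_eq hU hdL heL fun φ hφ => ?_
  have h := neg_injective ((hd φ hφ).symm.trans (he φ hφ))
  simpa only [smul_eq_mul, mul_comm] using h

/-- The weak divergences agree almost everywhere, so subtracting the two Green formulas leaves a
function whose integral against every test function vanishes. Test functions see all edges at once,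
hence the sum `μ` of the edge measures, which dominates each of them. -/
theorem IsNormalTrace.ae_eq {K : Element} {σ : Plane → Plane} {g g' : Plane → ℝ}
    (hg : IsNormalTrace K σ g) (hg' : IsNormalTrace K σ g') (i : Fin (K.m + 3)) :
    g =ᵐ[K.edgeMeasure i] g' := by
  obtain ⟨-, hgL, d, hdL, hd, h⟩ := hg
  obtain ⟨-, hgL', d', hdL', hd', h'⟩ := hg'
  have hdd := hd.ae_eq K.isOpen hd' hdL hdL'
  set μ : Measure Plane := ∑ i, K.edgeMeasure i with hμ
  have hle : K.edgeMeasure i ≤ μ := by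
    rw [hμ, ← Measure.sum_fintype]
    exact Measure.le_sum _ i
  have hint : Integrable (fun x => g x - g' x) μ :=
    integrable_finsetSum_measure.2 fun i _ =>
      ((hgL i).sub (hgL' i)).integrable (by norm_num)
  have key := ae_eq_zero_of_integral_contDiff_smul_eq_zero hint.locallyIntegrable
    fun φ hφ hc => ?_
  · exact Filter.Eventually.mono (ae_mono hle key) fun x hx => sub_eq_zero.1 hx
  · have hi : ∀ {f : Plane → ℝ}, (∀ i, MemLp f 2 (K.edgeMeasure i)) → ∀ i,
        Integrable (fun x => f x * φ x) (K.edgeMeasure i) := fun hf i =>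
      (hf i).integrable_mul (K.memLp_edgeMeasure_of_continuous i hφ.continuous)
    have hφi : ∀ i ∈ Finset.univ, Integrable (fun x => φ x • (g x - g' x)) (K.edgeMeasure i) :=
      fun i _ => by
        refine ((hi hgL i).sub (hi hgL' i)).congr (Eventually.of_forall fun x => ?_)
        simp only [Pi.sub_apply, smul_eq_mul]; ring
    rw [hμ, integral_finsetSum_measure hφi]
    have e : ∀ i, ∫ x, φ x • (g x - g' x) ∂(K.edgeMeasure i) =
        ∫ x, g x * φ x ∂(K.edgeMeasure i) - ∫ x, g' x * φ x ∂(K.edgeMeasure i) := fun i => by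
      rw [← integral_sub (hi hgL i) (hi hgL' i)]
      refine integral_congr_ae (Eventually.of_forall fun x => ?_)
      simp only [smul_eq_mul]; ring
    simp_rw [e]
    rw [Finset.sum_sub_distrib, ← h φ hφ hc, ← h' φ hφ hc, sub_eq_zero]
    congr 1
    exact integral_congr_ae (hdd.mono fun x hx => by simp only [hx])

/-- The trace bound applied to differences of smooth approximants makes their restrictions Cauchy in
`L²` of the edge; the limit is the trace. -/
theorem exists_isTrace {K : Element} {C : ℝ} (hC : 0 < C) (hK : K.IsRegular C)
    (i : Fin (K.m + 3)) {u : Plane → ℝ} {G : Plane → Plane} (hu : IsH1 K.carrier u G) :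
    ∃ g, IsTrace K i u g := by
  obtain ⟨M, hM, hbound⟩ := K.exists_eLpNorm_edgeMeasure_le i hC hK
  obtain ⟨-, z, hz, hstar⟩ := hK
  obtain ⟨w, hw, hwu, hwG⟩ := exists_contDiff_tendsto_of_isH1 K.isOpen K.isBounded
    (mul_pos hC K.diam_pos) hstar hu
  set V := (volume : Measure Plane).restrict K.carrier with hV
  set e : ℕ → ENNReal := fun n => M * (eLpNorm (fun x => w n x - u x) 2 V +
    eLpNorm (fun x => gradient (w n) x - G x) 2 V) with he
  have he0 : Tendsto e atTop (𝓝 0) := by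
    simpa using ENNReal.Tendsto.const_mul (hwu.add hwG) (Or.inr hM)
  have hwL : ∀ n, MemLp (w n) 2 (K.edgeMeasure i) := fun n =>
    K.memLp_edgeMeasure_of_continuous i (hw n).continuous
  have hdiff : ∀ m n, eLpNorm (w m - w n) 2 (K.edgeMeasure i) ≤ e m + e n := by
    intro m n
    refine (hbound _ ((hw m).sub (hw n))).trans ?_
    have hmu : ∀ n, AEStronglyMeasurable (fun x => w n x - u x) V := fun n =>
      (hw n).continuous.aestronglyMeasurable.sub hu.memLp.1
    have hmG : ∀ n, AEStronglyMeasurable (fun x => gradient (w n) x - G x) V := fun n =>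
      (measurable_gradient (hw n)).aestronglyMeasurable.sub hu.memLp_grad.1
    have e1 : w m - w n = (fun x => w m x - u x) - fun x => w n x - u x := by
      ext x; simp
    have e2 : gradient (w m - w n) =
        (fun x => gradient (w m) x - G x) - fun x => gradient (w n) x - G x := by
      ext1 x
      have hm := ((hw m).differentiable (by simp)) x
      have hn := ((hw n).differentiable (by simp)) x
      simp only [Pi.sub_apply, sub_sub_sub_cancel_right]
      rw [gradient, fderiv_sub hm hn, map_sub]
      rfl
    have b1 : eLpNorm (w m - w n) 2 V ≤ eLpNorm (fun x => w m x - u x) 2 V +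
        eLpNorm (fun x => w n x - u x) 2 V := by
      rw [e1]
      exact eLpNorm_sub_le (hmu m) (hmu n) (by norm_num)
    have b2 : eLpNorm (gradient (w m - w n)) 2 V ≤
        eLpNorm (fun x => gradient (w m) x - G x) 2 V +
          eLpNorm (fun x => gradient (w n) x - G x) 2 V := by
      rw [e2]
      exact eLpNorm_sub_le (hmG m) (hmG n) (by norm_num)
    refine (mul_le_mul_right (add_le_add b1 b2) M).trans_eq ?_
    simp only [he]
    ring
  have hcau : CauchySeq fun n => (hwL n).toLp (w n) := by
    rw [EMetric.cauchySeq_iff]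
    intro ε hε
    obtain ⟨N, hN⟩ := eventually_atTop.1 (he0.eventually_lt_const (ENNReal.half_pos hε.ne'))
    refine ⟨N, fun m hm n hn => ?_⟩
    rw [Lp.edist_toLp_toLp]
    refine (hdiff m n).trans_lt ((ENNReal.add_lt_add (hN m hm) (hN n hn)).trans_eq ?_)
    exact ENNReal.add_halves ε
  obtain ⟨g, hg⟩ := cauchySeq_tendsto_of_complete hcau
  refine ⟨g, Lp.memLp g, G, w, hu, hw, hwu, hwG, ?_⟩
  have h1 := (Lp.tendsto_Lp_iff_tendsto_eLpNorm'' w hwL g (Lp.memLp g)).1 (by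
    rwa [Lp.toLp_coeFn])
  exact h1

/-- The constant comes from a single smooth approximant and changes with it; the slack `ε` makes
convergence of these constants unnecessary. -/
theorem IsTrace.exists_eLpNorm_sub_le {K : Element} {C : ℝ} (hC : 0 < C) (hK : K.IsRegular C)
    {i : Fin (K.m + 3)} {u g : Plane → ℝ} {G : Plane → Plane} (hg : IsTrace K i u g)
    (hu : IsH1 K.carrier u G) {ε : ENNReal} (hε : ε ≠ 0) :
    ∃ c : ℝ, eLpNorm (fun x => g x - c) 2 (K.edgeMeasure i) ≤
      ENNReal.ofReal (3 / C * Real.sqrt (K.edgeLength i)) *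
        eLpNorm G 2 (volume.restrict K.carrier) + ε := by
  obtain ⟨hgL, H, w, hH, hw, hwu, hwH, hwg⟩ := hg
  rw [eLpNorm_congr_ae (hu.grad_ae_eq K.isOpen hH)]
  set A := ENNReal.ofReal (3 / C * Real.sqrt (K.edgeLength i))
  set V := (volume : Measure Plane).restrict K.carrier with hV
  have hlim : Tendsto (fun n => eLpNorm (fun x => w n x - g x) 2 (K.edgeMeasure i) +
      A * (eLpNorm (fun x => gradient (w n) x - H x) 2 V + eLpNorm H 2 V)) atTop
      (𝓝 (A * eLpNorm H 2 V)) := by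
    simpa using hwg.add (ENNReal.Tendsto.const_mul (hwH.add_const (eLpNorm H 2 V))
      (Or.inr ENNReal.ofReal_ne_top))
  have hfin : A * eLpNorm H 2 V ≠ ⊤ := ENNReal.mul_ne_top ENNReal.ofReal_ne_top hH.memLp_grad.2.ne
  obtain ⟨n, hn⟩ := (hlim.eventually_lt_const (ENNReal.lt_add_right hfin hε)).exists
  obtain ⟨c, hc⟩ := K.exists_eLpNorm_edgeMeasure_sub_le i hC hK (hw n)
  refine ⟨c, le_trans ?_ hn.le⟩
  have e1 : (fun x => g x - c) = (fun x => w n x - c) - fun x => w n x - g x := by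
    ext x; simp
  have hm := (hw n).continuous.aestronglyMeasurable (μ := K.edgeMeasure i)
  rw [e1]
  refine (eLpNorm_sub_le (hm.sub aestronglyMeasurable_const) (hm.sub hgL.1) (by norm_num)).trans ?_
  rw [add_comm]
  refine add_le_add le_rfl (hc.trans (mul_le_mul_right ?_ A))
  have e2 : gradient (w n) = (fun x => gradient (w n) x - H x) + H := by
    ext1 x; simp
  conv_lhs => rw [e2]
  exact eLpNorm_add_le ((measurable_gradient (hw n)).aestronglyMeasurable.sub hH.memLp_grad.1)
    hH.memLp_grad.1 (by norm_num)

/-! ### Polynomials and best approximation -/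

theorem IsPoly.continuous {m : ℤ} {f : Plane → ℝ} (hf : IsPoly m f) : Continuous f := by
  obtain ⟨p, -, hp⟩ := hf
  have : f = fun x : Plane => MvPolynomial.eval (fun i => x i) p := funext hp
  rw [this]
  exact (MvPolynomial.continuous_eval p).comp (by fun_prop)

theorem IsPoly.const_sub {m : ℤ} (hm : 0 ≤ m) {f : Plane → ℝ} (hf : IsPoly m f) (c : ℝ) :
    IsPoly m fun x => c - f x := by
  classical
  obtain ⟨p, hdeg, hp⟩ := hf
  refine ⟨MvPolynomial.C c - p, fun α hα => ?_, fun x => by simp [hp]⟩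
  rcases Finset.mem_union.1 (MvPolynomial.support_sub _ _ _ hα) with h | h
  · rw [MvPolynomial.support_C] at h
    split_ifs at h
    · simp at h
    · rw [Finset.mem_singleton.1 h]
      simpa using hm
  · exact hdeg α h

/-- Pythagoras; this yields the best approximation property of `τI · ν`. -/
theorem eLpNorm_le_eLpNorm_add_of_integral_mul_eq_zero {α : Type*} [MeasurableSpace α]
    {μ : Measure α} {f g : α → ℝ} (hf : MemLp f 2 μ) (hg : MemLp g 2 μ)
    (h : ∫ x, f x * g x ∂μ = 0) : eLpNorm f 2 μ ≤ eLpNorm (f + g) 2 μ := by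
  refine (ENNReal.pow_le_pow_left_iff two_ne_zero).1 ?_
  have e : ∀ {f : α → ℝ}, MemLp f 2 μ → eLpNorm f 2 μ ^ 2 = ENNReal.ofReal (∫ x, f x ^ 2 ∂μ) := by
    intro f hf
    rw [eLpNorm_two_sq, ofReal_integral_eq_lintegral_ofReal hf.integrable_sq
      (Eventually.of_forall fun x => sq_nonneg _)]
    refine lintegral_congr fun x => ?_
    rw [← ofReal_norm, ← ENNReal.ofReal_pow (norm_nonneg _), Real.norm_eq_abs, sq_abs]
  rw [e hf, e (hf.add hg)]
  apply ENNReal.ofReal_le_ofReal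
  have hfg : Integrable (fun x => f x * g x) μ := hf.integrable_mul hg
  have e1 : ∫ x, (f + g) x ^ 2 ∂μ =
      ((∫ x, f x ^ 2 ∂μ) + 2 * ∫ x, f x * g x ∂μ) + ∫ x, g x ^ 2 ∂μ := by
    have i1 : Integrable (fun x => f x ^ 2 + 2 * (f x * g x)) μ :=
      hf.integrable_sq.add (hfg.const_mul 2)
    rw [← integral_const_mul, ← integral_add hf.integrable_sq (hfg.const_mul 2),
      ← integral_add i1 hg.integrable_sq]
    refine integral_congr_ae (Eventually.of_forall fun x => ?_)
    simp only [Pi.add_apply]; ring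
  rw [e1, h]
  have : 0 ≤ ∫ x, g x ^ 2 ∂μ := integral_nonneg fun x => sq_nonneg _
  linarith

theorem inner_eq_add (x y : Plane) : ⟪x, y⟫ = x 0 * y 0 + x 1 * y 1 := by
  simp [PiLp.inner_apply, Fin.sum_univ_two, mul_comm]

theorem eLpNorm_le_ofReal_h1Seminorm {U : Set Plane} {G : Fin 2 → Plane → Plane}
    (hG : ∀ j, MemLp (G j) 2 (volume.restrict U)) (j : Fin 2) :
    eLpNorm (G j) 2 (volume.restrict U) ≤ ENNReal.ofReal (h1Seminorm U G) := by
  refine (ENNReal.pow_le_pow_left_iff two_ne_zero).1 ?_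
  have hnn : ∀ j, 0 ≤ ∫ x in U, ‖G j x‖ ^ 2 := fun j => integral_nonneg fun x => sq_nonneg _
  rw [h1Seminorm, ← ENNReal.ofReal_pow (Real.sqrt_nonneg _),
    Real.sq_sqrt (Finset.sum_nonneg fun j _ => hnn j), eLpNorm_two_sq]
  have e : ∫⁻ x in U, ‖G j x‖ₑ ^ 2 = ENNReal.ofReal (∫ x in U, ‖G j x‖ ^ 2) := by
    rw [ofReal_integral_eq_lintegral_ofReal (hG j).norm.integrable_sq
      (Eventually.of_forall fun x => sq_nonneg _)]
    refine lintegral_congr fun x => ?_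
    rw [← ofReal_norm, ← ENNReal.ofReal_pow (norm_nonneg _)]
  rw [e]
  exact ENNReal.ofReal_le_ofReal
    (Finset.single_le_sum (f := fun j => ∫ x in U, ‖G j x‖ ^ 2) (fun j _ => hnn j)
      (Finset.mem_univ j))

theorem eLpNorm_inner_normal_sub_le {K : Element} {i : Fin (K.m + 3)} {t : Plane → Plane}
    (ht : ∀ j, MemLp (fun x => t x j) 2 (K.edgeMeasure i)) (c : Fin 2 → ℝ) :
    eLpNorm (fun x => ⟪t x, K.normal i⟫ - (c 0 * K.normal i 0 + c 1 * K.normal i 1)) 2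
      (K.edgeMeasure i) ≤ eLpNorm (fun x => t x 0 - c 0) 2 (K.edgeMeasure i) +
        eLpNorm (fun x => t x 1 - c 1) 2 (K.edgeMeasure i) := by
  have e : (fun x => ⟪t x, K.normal i⟫ - (c 0 * K.normal i 0 + c 1 * K.normal i 1)) =
      K.normal i 0 • (fun x => t x 0 - c 0) + K.normal i 1 • (fun x => t x 1 - c 1) := by
    ext x
    simp only [inner_eq_add, Pi.add_apply, Pi.smul_apply, smul_eq_mul]
    ring
  have hm : ∀ j, AEStronglyMeasurable (fun x => t x j - c j) (K.edgeMeasure i) := fun j =>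
    (ht j).1.sub aestronglyMeasurable_const
  have h1 : ∀ j, ‖K.normal i j‖ₑ ≤ 1 := fun j => by
    rw [← ofReal_norm]
    exact ENNReal.ofReal_le_one.2 (K.abs_normal_le_one i j)
  rw [e]
  refine (eLpNorm_add_le ((hm 0).const_smul _) ((hm 1).const_smul _) (by norm_num)).trans ?_
  rw [eLpNorm_const_smul, eLpNorm_const_smul]
  exact add_le_add (mul_le_of_le_one_left' (h1 0)) (mul_le_of_le_one_left' (h1 1))

end MixedVEM

end

/-! ### The interpolation error on an edge -/

theorem mainTheorem6 (C : ℝ) (hC : 0 < C) :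
    ∃ c : ℝ, 0 < c ∧
      ∀ (k : ℕ) (Ω : Set MixedVEM.Plane), MixedVEM.IsPolygonalDomain Ω →
      ∀ T : MixedVEM.Mesh Ω, T.IsRegular C →
      ∀ (τ : MixedVEM.Plane → MixedVEM.Plane)
        (G : Fin 2 → MixedVEM.Plane → MixedVEM.Plane), MixedVEM.IsVecH1 Ω τ G →
      ∀ τI : MixedVEM.Plane → MixedVEM.Plane, MixedVEM.IsInterpolant k T τ τI →
      ∀ K ∈ T.elements, ∀ i : Fin (K.m + 3),
        (∃ t, MixedVEM.IsVecTrace K i τ t) ∧ (∃ g, MixedVEM.IsNormalTrace K τI g) ∧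
        ∀ (t : MixedVEM.Plane → MixedVEM.Plane) (g : MixedVEM.Plane → ℝ),
          MixedVEM.IsVecTrace K i τ t → MixedVEM.IsNormalTrace K τI g →
          eLpNorm (fun x => ⟪t x, K.normal i⟫ - g x) 2 (K.edgeMeasure i) ≤
            ENNReal.ofReal
              (c * Real.sqrt (K.edgeLength i) * MixedVEM.h1Seminorm K.carrier G) := by
  -- The trace inequality contributes `3 / C` for each of the two components of `τ`.
  refine ⟨2 * (3 / C), by positivity, fun k Ω hΩ T hT τ G hτ τI hI K hK i => ?_⟩
  have hreg := hT K hK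
  have hH1 : ∀ j, MixedVEM.IsH1 K.carrier (fun x => τ x j) (G j) := fun j =>
    (hτ j).mono hΩ.isOpen.measurableSet (T.subset K hK)
  obtain ⟨g₀, hg₀, hpoly⟩ := (hI.mem.2 K hK).normal
  refine ⟨?_, ⟨g₀, hg₀⟩, fun t g ht hg => ?_⟩
  · choose s hs using fun j => MixedVEM.exists_isTrace hC hreg i (hH1 j)
    exact ⟨fun x => WithLp.toLp 2 fun j => s j x, hs⟩
  obtain ⟨p, hp, hgp⟩ := hpoly i
  have hgp : g =ᵐ[K.edgeMeasure i] p := (hg.ae_eq hg₀ i).trans hgp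
  have htL : ∀ j, MemLp (fun x => t x j) 2 (K.edgeMeasure i) := fun j => (ht j).1
  have hpL := K.memLp_edgeMeasure_of_continuous i hp.continuous
  have hgL : MemLp g 2 (K.edgeMeasure i) := hg.2.1 i
  have htn : MemLp (fun x => ⟪t x, K.normal i⟫) 2 (K.edgeMeasure i) := by
    simp only [MixedVEM.inner_eq_add]
    exact ((htL 0).mul_const _).add ((htL 1).mul_const _)
  have hbest : ∀ r : ℝ, eLpNorm (fun x => ⟪t x, K.normal i⟫ - g x) 2 (K.edgeMeasure i) ≤
      eLpNorm (fun x => ⟪t x, K.normal i⟫ - r) 2 (K.edgeMeasure i) := by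
    intro r
    -- The moment condition is tested with `r - p`, where `p` is the polynomial equal to `g` on the
    -- edge; it lies in `P_k` because constants do. Adding its negative to the error yields `τ · ν -
    -- r`.
    have hq := hp.const_sub (Int.natCast_nonneg k) r
    have hqL := K.memLp_edgeMeasure_of_continuous i hq.continuous
    have hmom := hI.edge_moments K hK i t g ht hg _ hq
    have horth : ∫ x, (⟪t x, K.normal i⟫ - g x) * -(r - p x) ∂(K.edgeMeasure i) = 0 := by
      have i1 : Integrable (fun x => (r - p x) * g x) (K.edgeMeasure i) := hqL.integrable_mul hgL
      have i2 : Integrable (fun x => (r - p x) * ⟪t x, K.normal i⟫) (K.edgeMeasure i) :=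
        hqL.integrable_mul htn
      rw [← sub_eq_zero, ← integral_sub i1 i2] at hmom
      rw [← hmom]
      refine integral_congr_ae (Eventually.of_forall fun x => ?_)
      ring
    refine (MixedVEM.eLpNorm_le_eLpNorm_add_of_integral_mul_eq_zero (htn.sub hgL) hqL.neg
      horth).trans_eq (eLpNorm_congr_ae (hgp.mono fun x hx => ?_))
    simp only [Pi.add_apply, Pi.sub_apply, Pi.neg_apply, hx]
    ring
  set A := ENNReal.ofReal (3 / C * Real.sqrt (K.edgeLength i)) with hA
  have hfinal : eLpNorm (fun x => ⟪t x, K.normal i⟫ - g x) 2 (K.edgeMeasure i) ≤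
      A * ENNReal.ofReal (MixedVEM.h1Seminorm K.carrier G) +
        A * ENNReal.ofReal (MixedVEM.h1Seminorm K.carrier G) := by
    -- The approximating constants depend on `ε`, but the left side does not, so `ε` can tend to
    -- zero; each component receives half of it.
    refine ENNReal.le_of_forall_pos_le_add fun ε hε _ => ?_
    have hε2 : (ε : ENNReal) / 2 ≠ 0 := (ENNReal.half_pos (by simpa using hε.ne')).ne'
    choose c hc using fun j => (ht j).exists_eLpNorm_sub_le hC hreg (hH1 j) hε2
    refine (hbest _).trans ((MixedVEM.eLpNorm_inner_normal_sub_le htL c).trans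
      ((add_le_add (hc 0) (hc 1)).trans ?_))
    have hG := MixedVEM.eLpNorm_le_ofReal_h1Seminorm fun j => (hH1 j).memLp_grad
    calc _ ≤ (A * ENNReal.ofReal (MixedVEM.h1Seminorm K.carrier G) + (ε : ENNReal) / 2) +
          (A * ENNReal.ofReal (MixedVEM.h1Seminorm K.carrier G) + (ε : ENNReal) / 2) := by
          gcongr
          · exact hG 0
          · exact hG 1
      _ = _ := by rw [add_add_add_comm, ENNReal.add_halves]
  refine hfinal.trans_eq ?_
  rw [← two_mul, hA, ← ENNReal.ofReal_mul (by positivity), ← ENNReal.ofReal_ofNat,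
    ← ENNReal.ofReal_mul (by norm_num)]
  congr 1
  ring
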